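/- Let $K$ be a field of prime characteristic $p$, complete with respect to a nontrivial absolute value $|\cdot|$ (which is automatically non-Archimedean), and let $\widehat K$ be the completion of the algebraic closure of $K$ with respect to the extended absolute value. Let $\lambda\in K$ be not a root of unity and such that $|1-\lambda^n|<1$ for some $n\ge 1$. Put $$m=\min\{n\ge 1: |1-\lambda^n|<1\},\qquad k'=\min\{k\ge 1:\ p\mid k,\ m\mid k-1\}.$$ Let $a>0$ be real, let $\sigma=|1-\lambda^m|^{1/(k'-1)}/a$, and let $\mathcal F^p_{\lambda,a}(K)$ be the set of power series $f(x)=\lambda x+\sum_{i\ge 2,\ p\mid i}a_ix^i\in K[[x]]$ with $\sup_{i\ge2}|a_i|^{1/(i-1)}=a$. The formal conjugacy of $f$ is the power series $g$ with $g(0)=0$, $g'(0)=1$ and $g\circ f=\lambda g$, and $g^{-1}$ is its compositional inverse power series. The full conjugacy holds on a set $U$ if for every $x\in U$ the series $g^{-1}$ converges at $x$, $g$ and $f$ converge at $g^{-1}(x)$ with $g(g^{-1}(x))=x$, $g$ converges at $f(g^{-1}(x))$, and $g(f(g^{-1}(x)))=\lambda x$. The linearization disc of $f$ about the origin is the largest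 (open or closed) disc of positive radius about $0$ on which the full conjugacy holds. For a nonzero power series $h=\sum c_kx^k$ converging on a closed disc of $\widehat K$ whose radius lies in $|\widehat K^*|$ and is at least $r>0$, the Weierstrass degree $\deg(h,\overline D_r(0))$ is the largest $k$ with $|c_k|r^k=\max_j|c_j|r^j$. **Theorem.** Let $f\in\mathcal F^p_{\lambda,a}(K)$. Suppose $a=|a_{k'}|^{1/(k'-1)}$ and $|a_i|<a^{i-1}$ for all $2\le i<k'$. Then: 1. the linearization disc of $f$ about the origin is the open disc $D_\sigma(0)$, both in $K$ and in $\widehat K$; 2. the formal conjugacy $g\in K[[x]]$ of $f$ exists and is unique, and in $\widehat K$ one has $\deg(g,\overline D_\sigma(0))=k'$; 3. $f$ has an indifferent periodic point $\hat x\in\widehat K$ with $|\hat x|=\sigma$, of minimal period $\kappa$ with $1\le\kappa\le k'$ and multiplier $(f^{\circ\kappa})'(\hat x)=\lambda^\kappa$ (of absolute value $1$), where $f$ converges at all points of the orbit of $\hat x$. (In particular this applies to $f(x)=\lambda x+\sum_{i\ge k'}a_ix^i$ in $\mathcal F^p_{\lambda,a}(K)$ with $a=|a_{k'}|^{1/(k'-1)}$.)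 -/

import Mathlib

open scoped PowerSeries

noncomputable section

namespace NonArchLin

/-! ### The completed algebraic closure -/

/-- A normed field of prime characteristic is automatically non-Archimedean. -/
theorem isUltrametricDist_of_charP (p : ℕ) [Fact p.Prime] (K : Type*) [NormedField K]
    [CharP K p] : IsUltrametricDist K := by
  refine IsUltrametricDist.isUltrametricDist_of_forall_norm_natCast_le_one (fun n => ?_)
  have h : (n : K) ^ p = (n : K) := map_natCast (frobenius K p) n
  have h3 : ‖(n : K)‖ ^ p = ‖(n : K)‖ := by rw [← norm_pow, h]
  by_contra! hn
  have h4 : ‖(n : K)‖ ^ 1 < ‖(n : K)‖ ^ p := pow_lt_pow_right₀ hn (Fact.out : p.Prime).one_lt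
  rw [h3, pow_one] at h4
  exact lt_irrefl _ h4

/-- The algebraic closure of a complete field `K` of characteristic `p` (the characteristic is
recorded only so that the norm below can be an instance). -/
def AlgCl (_p : ℕ) (K : Type*) [Field K] : Type _ := AlgebraicClosure K

variable (p : ℕ) [Fact p.Prime] (K : Type*) [NontriviallyNormedField K] [CompleteSpace K]
  [CharP K p]

/-- The algebraic closure carries the unique extension of the absolute value of `K`. -/
instance : NontriviallyNormedField (AlgCl p K) :=
  haveI : IsUltrametricDist K := isUltrametricDist_of_charP p K
  spectralNorm.nontriviallyNormedField K (AlgebraicClosure K)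

/-- `K̂`, the completion of the algebraic closure of `K`. -/
abbrev Khat : Type _ := UniformSpace.Completion (AlgCl p K)

instance : NontriviallyNormedField (Khat p K) where
  toNormedField := inferInstance
  non_trivial := by
    obtain ⟨x, hx⟩ := NontriviallyNormedField.non_trivial (α := AlgCl p K)
    exact ⟨(x : Khat p K), by rwa [UniformSpace.Completion.norm_coe]⟩

/-- The inclusion of `K` into its algebraic closure. -/
def toAlgCl : K →+* AlgCl p K := algebraMap K (AlgebraicClosure K)

/-- The inclusion of `K` into `K̂`. -/
def toKhat : K →+* Khat p K := UniformSpace.Completion.coeRingHom.comp (toAlgCl p K)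

theorem norm_toKhat (x : K) : ‖toKhat p K x‖ = ‖x‖ := by
  have : IsUltrametricDist K := isUltrametricDist_of_charP p K
  change ‖((toAlgCl p K x : AlgCl p K) : Khat p K)‖ = ‖x‖
  rw [UniformSpace.Completion.norm_coe]
  exact spectralNorm_extends (L := AlgebraicClosure K) x

end NonArchLin

namespace NonArchLin

/-! ### The parameters `m`, `k'`, `σ` and the family of power series -/

/-- `m(λ) = min {n ≥ 1 : |1 - λ ^ n| < 1}` (meaningful when such an `n` exists). -/
def mIdx {K : Type*} [NormedField K] (lam : K) : ℕ :=
  sInf {n : ℕ | 1 ≤ n ∧ ‖1 - lam ^ n‖ < 1}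

/-- `k'(λ) = min {k ≥ 1 : p ∣ k and m ∣ k - 1}`. -/
def kPrime {K : Type*} [NormedField K] (p : ℕ) (lam : K) : ℕ :=
  sInf {k : ℕ | 1 ≤ k ∧ p ∣ k ∧ mIdx lam ∣ k - 1}

/-- `σ(λ, a) = |1 - λ ^ m| ^ (1 / (k' - 1)) / a`. -/
def sigma {K : Type*} [NormedField K] (p : ℕ) (lam : K) (a : ℝ) : ℝ :=
  ‖1 - lam ^ mIdx lam‖ ^ (1 / ((kPrime p lam : ℝ) - 1)) / a

/-- The power series `λ x + ∑_{i ≥ 2, p ∣ i} a_i x ^ i` with `a = sup_{i ≥ 2} |a_i| ^ (1 / (i - 1))`. -/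
def family {K : Type*} [NormedField K] (p : ℕ) (lam : K) (a : ℝ) : Set K⟦X⟧ :=
  {f | f.coeff 0 = 0 ∧ f.coeff 1 = lam ∧ (∀ i, 2 ≤ i → ¬ p ∣ i → f.coeff i = 0) ∧
    IsLUB {r : ℝ | ∃ i : ℕ, 2 ≤ i ∧ r = ‖f.coeff i‖ ^ (1 / ((i : ℝ) - 1))} a}

/-! ### Power series as functions -/

variable {L : Type*} [NontriviallyNormedField L]

/-- The power series `h` converges at `x`. -/
def ConvergesAt (h : L⟦X⟧) (x : L) : Prop := Summable fun n : ℕ => h.coeff n * x ^ n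

/-- The sum of the power series `h` at `x` (used only at points of convergence). -/
def evalAt (h : L⟦X⟧) (x : L) : L := ∑' n : ℕ, h.coeff n * x ^ n

/-! ### Linearization -/

/-- `g` is the formal conjugacy of `f`: `g(0) = 0`, `g'(0) = 1` and `g ∘ f = λ g` with
`λ = f'(0)`, as formal power series (`PowerSeries.subst f g` is `g ∘ f`). -/
def IsFormalConjugacy (f g : L⟦X⟧) : Prop :=
  g.coeff 0 = 0 ∧ g.coeff 1 = 1 ∧ PowerSeries.subst f g = PowerSeries.C (f.coeff 1) * g

/-- `h` is the formal compositional inverse `g⁻¹`: `h(0) = 0` and `g ∘ h = x`. -/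
def IsFormalInverse (g h : L⟦X⟧) : Prop :=
  h.coeff 0 = 0 ∧ PowerSeries.subst h g = PowerSeries.X

/-- The full conjugacy `g ∘ f ∘ g⁻¹ (x) = λ x` holds at the point `x`, where `h = g⁻¹`:
all the series involved converge at the points where they are evaluated, `h x` is a preimage of `x`
under `g`, and the identity holds. -/
def FullConjugacyAt (f g h : L⟦X⟧) (x : L) : Prop :=
  ConvergesAt h x ∧ ConvergesAt g (evalAt h x) ∧ evalAt g (evalAt h x) = x ∧
  ConvergesAt f (evalAt h x) ∧ ConvergesAt g (evalAt f (evalAt h x)) ∧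
  evalAt g (evalAt f (evalAt h x)) = f.coeff 1 * x

/-- The full conjugacy holds on the set `U`. -/
def FullConjugacyOn (f : L⟦X⟧) (U : Set L) : Prop :=
  ∃ g h : L⟦X⟧, IsFormalConjugacy f g ∧ IsFormalInverse g h ∧ ∀ x ∈ U, FullConjugacyAt f g h x

/-- Open and closed discs of positive radius about the origin. -/
def IsDiscAtZero (U : Set L) : Prop :=
  ∃ r : ℝ, 0 < r ∧ (U = Metric.ball 0 r ∨ U = Metric.closedBall 0 r)

/-- `U` is the linearization disc of `f` about the origin: the maximal disc about the origin on
which the full conjugacy holds. -/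
def IsLinearizationDisc (f : L⟦X⟧) (U : Set L) : Prop :=
  IsGreatest {V : Set L | IsDiscAtZero V ∧ FullConjugacyOn f V} U

/-! ### Weierstrass degree -/

/-- `deg (h, D̄_r(0)) = d`: the series `h ≠ 0` converges on a rational closed disc containing
`D̄_r(0)`, and `d` is the largest index at which `max_k |c_k| r ^ k` is attained. -/
def HasWeierstrassDegree (h : L⟦X⟧) (r : ℝ) (d : ℕ) : Prop :=
  h ≠ 0 ∧ 0 < r ∧ (∃ u : L, r ≤ ‖u‖ ∧ ∀ x : L, ‖x‖ ≤ ‖u‖ → ConvergesAt h x) ∧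
  ∃ s : ℝ, IsGreatest {t : ℝ | ∃ k : ℕ, t = ‖h.coeff k‖ * r ^ k} s ∧
    IsGreatest {k : ℕ | ‖h.coeff k‖ * r ^ k = s} d

/-! ### Periodic points -/

/-- `x` is an indifferent periodic point of `f`, of (minimal) period `κ` and multiplier
`(f^κ)'(x) = μ`; the series `f` converges at every point of the orbit of `x`. -/
def IsIndifferentPeriodicPoint (f : L⟦X⟧) (x : L) (κ : ℕ) (μ : L) : Prop :=
  (∀ n : ℕ, ConvergesAt f ((evalAt f)^[n] x)) ∧
  0 < κ ∧ Function.minimalPeriod (evalAt f) x = κ ∧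
  HasDerivAt (evalAt f)^[κ] μ x ∧ ‖μ‖ = 1

end NonArchLin

end

open NonArchLin

/-!
The conjugacy `g` is found from `g ∘ f = λ g` by a triangular recursion: its coefficient `g_k` is
`(λ - λ ^ k)⁻¹ ∑_{l < k} g_l [x ^ k] f ^ l`. Since `f - λ x` is a series in `x ^ p`, Frobenius
forces `g - x` to be one too (`IsFormalConjugacy.coeff_eq_zero`), so only divisors with `p ∣ k` matter. For
those, `λ - λ ^ k` has absolute value `1` unless `m ∣ k - 1`, in which case `k - 1` is prime to `p`
and the absolute value is `δ = |1 - λ ^ m|` (`norm_sub_pow_of_dvd`). The small divisors thus sit at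
`k = k' + m p j`, and counting them gives `|g_k| ≤ a ^ (k - 1) δ ^ (-N k)` with `N k` the number of
small divisors up to `k` (`norm_coeff_conjugacy_le`). As `k' - 1 < m p`, comparison with
`(a σ) ^ (k' - 1) = δ` yields `|g_k| σ ^ k ≤ σ`, with equality exactly at `k = 1` and `k = k'`, and
`|g_k| σ ^ k → 0`; equality at `k'` is where the hypotheses on the coefficients of `f` enter. These
facts are recorded in the structure `CriticalConjugacy`, from which everything else follows, over
`K` as well as over `K̂`.

The series `x + ⋯` whose Gauss norm at radius `σ` is at most `σ` form a group under composition, so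
`g⁻¹` converges on the open disc of radius `σ`, maps it to itself, and the full conjugacy holds
there. The reason why nothing larger is possible, and the source of the periodic point, is a zero
of `g` in `K̂` of absolute value `σ`. The roots of the truncation of `g` at degree `k'`, apart from
`0`, have absolute value `σ`, and because `g' = 1` the iteration `x ↦ x - g x` carries such a root
to a true zero `z` (`CriticalConjugacy.exists_zero`).

* If `g⁻¹` converged on the circle of radius `σ` (a condition on its coefficients, which can be
  tested in `K̂`), then `z = g⁻¹ (g z) = g⁻¹ 0 = 0`.
* Distinct zeros of `g` in the closed disc of radius `σ` are at distance exactly `σ`, and Lagrange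
  interpolation of the truncation of `g` shows that there are at most `k'` of them. By the
  functional equation `f` maps zeros to zeros, and `f` is an isometry, so `z` is periodic of period at most
  `k'`. As `f' = λ` identically, the multiplier of the cycle is a power of `λ`.
-/

namespace NonArchLin

/-! ### Formal power series: coefficients of a substitution, conjugacies and inverses -/

section Formal

open PowerSeries Finset

variable {L : Type*} [NontriviallyNormedField L]

theorem hasSubst_of_coeff_zero {F : L⟦X⟧} (hF : F.coeff 0 = 0) : HasSubst F :=
  HasSubst.of_constantCoeff_zero' (by simpa using hF)

theorem coeff_pow_eq_zero_of_lt {F : L⟦X⟧} (hF : F.coeff 0 = 0) {k l : ℕ} (hkl : k < l) :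
    (F ^ l).coeff k = 0 := by
  obtain ⟨B, rfl⟩ : X ∣ F := by rw [X_dvd_iff]; simpa using hF
  rw [mul_pow, coeff_X_pow_mul', if_neg (by omega)]

theorem coeff_pow_self {F : L⟦X⟧} (hF : F.coeff 0 = 0) (l : ℕ) :
    (F ^ l).coeff l = F.coeff 1 ^ l := by
  obtain ⟨B, rfl⟩ : X ∣ F := by rw [X_dvd_iff]; simpa using hF
  rw [mul_pow, coeff_X_pow_mul', if_pos le_rfl]
  have h1 : (X * B).coeff 1 = B.coeff 0 := by
    simp
  rw [h1]
  simp

theorem coeff_subst_eq_sum {F : L⟦X⟧} (hF : F.coeff 0 = 0) (g : L⟦X⟧) (k : ℕ) :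
    PowerSeries.coeff k (g.subst F) = ∑ l ∈ range (k + 1), g.coeff l * (F ^ l).coeff k := by
  rw [coeff_subst' (hasSubst_of_coeff_zero hF)]
  simp only [smul_eq_mul]
  refine finsum_eq_sum_of_support_subset _ fun l hl => ?_
  by_contra hlk
  refine hl ?_
  have hlt : k < l := by simpa using hlk
  simp [coeff_pow_eq_zero_of_lt hF hlt]

theorem coeff_conjugacy_mul {f g : L⟦X⟧} (hf : f.coeff 0 = 0) (hg : IsFormalConjugacy f g)
    (k : ℕ) : g.coeff k * (f.coeff 1 - f.coeff 1 ^ k) =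
      ∑ l ∈ range k, g.coeff l * (f ^ l).coeff k := by
  have h := congrArg (PowerSeries.coeff k) hg.2.2
  rw [coeff_subst_eq_sum hf, sum_range_succ, coeff_pow_self hf, coeff_C_mul] at h
  linear_combination -h

/-- The coefficients of the formal conjugacy, obtained by solving `g ∘ f = λ g` degree by degree. -/
noncomputable def conjugacyCoeff (f : L⟦X⟧) : ℕ → L
  | k => if k = 0 then 0 else if k = 1 then 1 else
      (∑ l : Fin k, conjugacyCoeff f l.1 * (f ^ l.1).coeff k) / (f.coeff 1 - f.coeff 1 ^ k)

theorem sub_pow_ne_zero {lam : L} (h0 : lam ≠ 0) (hroot : ∀ n : ℕ, 1 ≤ n → lam ^ n ≠ 1) {k : ℕ}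
    (hk : 2 ≤ k) : lam - lam ^ k ≠ 0 := by
  obtain ⟨n, rfl⟩ : ∃ n, k = n + 1 := ⟨k - 1, by omega⟩
  intro h
  have : lam * (1 - lam ^ n) = 0 := by rw [← h]; ring
  rcases mul_eq_zero.1 this with h | h
  · exact h0 h
  · exact hroot n (by omega) (sub_eq_zero.1 h).symm

theorem exists_isFormalConjugacy {f : L⟦X⟧} (hf : f.coeff 0 = 0) (h0 : f.coeff 1 ≠ 0)
    (hroot : ∀ n : ℕ, 1 ≤ n → f.coeff 1 ^ n ≠ 1) : ∃ g : L⟦X⟧, IsFormalConjugacy f g := by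
  have c0 : conjugacyCoeff f 0 = 0 := by rw [conjugacyCoeff]; simp
  have c1 : conjugacyCoeff f 1 = 1 := by rw [conjugacyCoeff]; simp
  refine ⟨PowerSeries.mk (conjugacyCoeff f), by simp [c0], by simp [c1], ?_⟩
  ext k
  rw [coeff_subst_eq_sum hf, sum_range_succ, coeff_pow_self hf, coeff_C_mul]
  simp only [coeff_mk]
  rcases Nat.lt_or_ge k 2 with hk | hk
  · interval_cases k
    · simp [c0]
    · simp [c0, c1]
  · have hne := sub_pow_ne_zero h0 hroot hk
    have := conjugacyCoeff.eq_1 f k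
    rw [if_neg (by omega), if_neg (by omega), eq_div_iff hne,
      Fin.sum_univ_eq_sum_range (fun l => conjugacyCoeff f l * (f ^ l).coeff k) k] at this
    linear_combination -this

theorem IsFormalConjugacy.unique {f g g' : L⟦X⟧} (hf : f.coeff 0 = 0) (h0 : f.coeff 1 ≠ 0)
    (hroot : ∀ n : ℕ, 1 ≤ n → f.coeff 1 ^ n ≠ 1) (hg : IsFormalConjugacy f g)
    (hg' : IsFormalConjugacy f g') : g' = g := by
  ext k
  induction k using Nat.strong_induction_on with
  | _ k ih =>
    rcases Nat.lt_or_ge k 2 with hk | hk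
    · interval_cases k
      · rw [hg.1, hg'.1]
      · rw [hg.2.1, hg'.2.1]
    · refine mul_right_cancel₀ (sub_pow_ne_zero h0 hroot hk) ?_
      rw [coeff_conjugacy_mul hf hg, coeff_conjugacy_mul hf hg']
      exact sum_congr rfl fun l hl => by rw [ih l (mem_range.1 hl)]

theorem exists_isFormalInverse {g : L⟦X⟧} (h0 : g.coeff 0 = 0) (h1 : g.coeff 1 = 1) :
    ∃ h : L⟦X⟧, IsFormalInverse g h := by
  have hu : IsUnit (g.coeff 1) := by simp [h1]
  exact ⟨g.substInvOfIsUnit hu, by simp,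
    subst_substInvOfIsUnit_right g (by simpa using h0) hu⟩

/-- A right inverse of `g` under composition is also a left inverse. -/
theorem IsFormalInverse.subst_left {g h : L⟦X⟧} (h0 : g.coeff 0 = 0) (h1 : g.coeff 1 = 1)
    (hh : IsFormalInverse g h) : h.subst g = (X : L⟦X⟧) := by
  have hu : IsUnit (g.coeff 1) := by simp [h1]
  have h0' : constantCoeff g = 0 := by simpa using h0
  have hl := subst_substInvOfIsUnit_left g h0' hu
  have key : g.substInvOfIsUnit hu = h := by
    have e := subst_comp_subst_apply (hasSubst_of_coeff_zero h0) (hasSubst_of_coeff_zero hh.1)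
      (g.substInvOfIsUnit hu)
    rw [hl, hh.2, subst_X (hasSubst_of_coeff_zero hh.1), X_subst] at e
    exact e.symm
  rwa [key] at hl

theorem IsFormalConjugacy.map {M : Type*} [NontriviallyNormedField M] (φ : L →+* M) {f g : L⟦X⟧}
    (hf : f.coeff 0 = 0) (hg : IsFormalConjugacy f g) :
    IsFormalConjugacy (f.map φ) (g.map φ) := by
  refine ⟨by rw [coeff_map, hg.1, map_zero], by rw [coeff_map, hg.2.1, map_one], ?_⟩
  have h := congrArg (PowerSeries.map φ) hg.2.2
  rw [map_mul, map_C] at h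
  rw [coeff_map, ← h]
  exact (PowerSeries.map_subst (hasSubst_of_coeff_zero hf) g).symm

theorem IsFormalInverse.map {M : Type*} [NontriviallyNormedField M] (φ : L →+* M) {g h : L⟦X⟧}
    (hh : IsFormalInverse g h) : IsFormalInverse (g.map φ) (h.map φ) := by
  refine ⟨by rw [coeff_map, hh.1, map_zero], ?_⟩
  have e := congrArg (PowerSeries.map φ) hh.2
  rw [map_X] at e
  rw [← e]
  exact (PowerSeries.map_subst (hasSubst_of_coeff_zero hh.1) g).symm

/-- In characteristic `p` the coefficients of `F ^ l` with `p ∣ l` are supported on multiples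
of `p`, by Frobenius. -/
theorem coeff_pow_eq_zero_of_dvd {p : ℕ} [Fact p.Prime] [CharP L p] (F : L⟦X⟧) {k l : ℕ}
    (hl : p ∣ l) (hk : ¬ p ∣ k) : (F ^ l).coeff k = 0 := by
  obtain ⟨j, rfl⟩ := hl
  have hp : p ≠ 0 := (Fact.out : p.Prime).ne_zero
  have h : PowerSeries.map (frobenius L p) ((F ^ j).expand p hp) = (F ^ j) ^ p :=
    MvPowerSeries.map_frobenius_expand p hp
  rw [mul_comm, pow_mul, ← h, coeff_map, coeff_expand_of_not_dvd p hp _ hk, map_zero]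

/-- If `f - λ x` is a series in `x ^ p`, then so is `g - x` for its conjugacy `g`. -/
theorem IsFormalConjugacy.coeff_eq_zero {p : ℕ} [Fact p.Prime] [CharP L p] {f g : L⟦X⟧}
    (hf : f.coeff 0 = 0) (h0 : f.coeff 1 ≠ 0)
    (hroot : ∀ n : ℕ, 1 ≤ n → f.coeff 1 ^ n ≠ 1)
    (hfp : ∀ i, 2 ≤ i → ¬ p ∣ i → f.coeff i = 0) (hg : IsFormalConjugacy f g) :
    ∀ k, 2 ≤ k → ¬ p ∣ k → g.coeff k = 0 := by
  intro k
  induction k using Nat.strong_induction_on with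
  | _ k ih =>
    intro hk hpk
    refine (mul_eq_zero.1 ?_).resolve_right (sub_pow_ne_zero h0 hroot hk)
    rw [coeff_conjugacy_mul hf hg]
    refine sum_eq_zero fun l hl => ?_
    rw [mem_range] at hl
    by_cases hpl : p ∣ l
    · rw [coeff_pow_eq_zero_of_dvd f hpl hpk, mul_zero]
    · have hl0 : l ≠ 0 := by rintro rfl; exact hpl (dvd_zero p)
      rcases Nat.lt_or_ge l 2 with h | h
      · obtain rfl : l = 1 := by omega
        rw [pow_one, hfp k hk hpk, mul_zero]
      · rw [ih l hl h hpl, zero_mul]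

end Formal

/-! ### Gauss norms and evaluation of power series over ultrametric fields -/

section Evaluation

open PowerSeries Finset Filter Topology

variable {L : Type*} [NontriviallyNormedField L]

/-- The Gauss norm of `f` at radius `r` is at most `r`: up to questions of convergence, `f` maps
the closed disc of radius `r` about the origin into itself. -/
def SelfBounded (f : L⟦X⟧) (r : ℝ) : Prop := ∀ k : ℕ, ‖f.coeff k‖ * r ^ k ≤ r

theorem SelfBounded.mono {f : L⟦X⟧} (h0 : f.coeff 0 = 0) {r s : ℝ} (hf : SelfBounded f r)
    (hs : 0 ≤ s) (hsr : s ≤ r) : SelfBounded f s := by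
  intro k
  rcases Nat.eq_zero_or_pos k with rfl | hk
  · simpa [h0] using hs
  obtain ⟨n, rfl⟩ : ∃ n, k = n + 1 := ⟨k - 1, by omega⟩
  rcases hs.eq_or_lt with rfl | hs'
  · simp
  have h1 : ‖f.coeff (n + 1)‖ * r ^ n ≤ 1 := by
    have := hf (n + 1)
    rw [pow_succ, ← mul_assoc] at this
    exact le_of_mul_le_mul_right (by linarith) (hs'.trans_le hsr)
  calc ‖f.coeff (n + 1)‖ * s ^ (n + 1) = (‖f.coeff (n + 1)‖ * s ^ n) * s := by ring
    _ ≤ (‖f.coeff (n + 1)‖ * r ^ n) * s := by gcongr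
    _ ≤ 1 * s := by gcongr
    _ = s := one_mul s

theorem ConvergesAt.tendsto {f : L⟦X⟧} {x : L} (h : ConvergesAt f x) :
    Tendsto (fun n => ‖f.coeff n‖ * ‖x‖ ^ n) atTop (𝓝 0) := by
  simpa using (Summable.tendsto_atTop_zero h).norm

variable [IsUltrametricDist L]

theorem SelfBounded.pow {f : L⟦X⟧} {r : ℝ} (hr : 0 ≤ r) (hf : SelfBounded f r) (l k : ℕ) :
    ‖(f ^ l).coeff k‖ * r ^ k ≤ r ^ l := by
  induction l generalizing k with
  | zero =>
    rcases Nat.eq_zero_or_pos k with rfl | hk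
    · simp
    · simp [coeff_one, hk.ne']
  | succ l ih =>
    rw [pow_succ, coeff_mul, ← abs_of_nonneg (pow_nonneg hr k), ← Real.norm_eq_abs]
    have hk : ‖r ^ k‖ = r ^ k := by simp [abs_of_nonneg hr]
    rcases hr.eq_or_lt with rfl | hr'
    · rcases Nat.eq_zero_or_pos k with rfl | hk
      · have := hf 0
        simp at this
        simp [this]
      · simp [hk.ne']
    rw [hk, ← le_div_iff₀ (pow_pos hr' k)]
    refine IsUltrametricDist.norm_sum_le_of_forall_le_of_nonneg (by positivity) fun q hq => ?_
    rw [HasAntidiagonal.mem_antidiagonal] at hq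
    rw [le_div_iff₀ (pow_pos hr' k), norm_mul, ← hq, pow_add, pow_succ]
    calc ‖(f ^ l).coeff q.1‖ * ‖f.coeff q.2‖ * (r ^ q.1 * r ^ q.2)
        = (‖(f ^ l).coeff q.1‖ * r ^ q.1) * (‖f.coeff q.2‖ * r ^ q.2) := by ring
      _ ≤ r ^ l * r := mul_le_mul (ih _) (hf _) (by positivity) (by positivity)

/-- The series `x + ...` of Gauss norm at most `r` at radius `r` form a group under composition. -/
theorem IsFormalInverse.selfBounded {g h : L⟦X⟧} {r : ℝ} (hr : 0 < r) (h0 : g.coeff 0 = 0)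
    (h1 : g.coeff 1 = 1) (hg : SelfBounded g r) (hh : IsFormalInverse g h) :
    SelfBounded h r := by
  intro k
  induction k using Nat.strong_induction_on with
  | _ k ih =>
    -- the left inverse property is linear in the coefficients of `h`
    have e := congrArg (PowerSeries.coeff k) (hh.subst_left h0 h1)
    rw [coeff_subst_eq_sum h0, sum_range_succ, coeff_pow_self h0, h1, one_pow, mul_one] at e
    rw [eq_sub_of_add_eq' e, ← le_div_iff₀ (pow_pos hr k), sub_eq_add_neg]
    refine (IsUltrametricDist.norm_add_le_max _ _).trans (max_le ?_ ?_)
    · rw [coeff_X]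
      split_ifs with hk
      · subst hk; simp [hr.ne']
      · simp; positivity
    · rw [norm_neg]
      refine IsUltrametricDist.norm_sum_le_of_forall_le_of_nonneg (by positivity) fun l hl => ?_
      rw [le_div_iff₀ (pow_pos hr k), norm_mul, mul_assoc]
      exact (mul_le_mul_of_nonneg_left (hg.pow hr.le l k) (norm_nonneg _)).trans
        (ih l (mem_range.1 hl))

variable [CompleteSpace L]

theorem convergesAt_of_tendsto {f : L⟦X⟧} {x : L}
    (h : Tendsto (fun n => ‖f.coeff n‖ * ‖x‖ ^ n) atTop (𝓝 0)) : ConvergesAt f x := by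
  refine NonarchimedeanAddGroup.summable_of_tendsto_cofinite_zero ?_
  rw [Nat.cofinite_eq_atTop]
  refine tendsto_zero_iff_norm_tendsto_zero.2 ?_
  simpa using h

omit [CompleteSpace L] [IsUltrametricDist L] in
theorem SelfBounded.tendsto {f : L⟦X⟧} {r : ℝ} (hf : SelfBounded f r) {s : ℝ} (hs0 : 0 ≤ s)
    (hs : s < r) : Tendsto (fun n => ‖f.coeff n‖ * s ^ n) atTop (𝓝 0) := by
  have hr : 0 < r := hs0.trans_lt hs
  have hlim : Tendsto (fun n => r * (s / r) ^ n) atTop (𝓝 0) := by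
    simpa using (tendsto_pow_atTop_nhds_zero_of_lt_one (by positivity)
      ((div_lt_one hr).2 hs)).const_mul r
  refine squeeze_zero (fun n => by positivity) (fun n => ?_) hlim
  calc ‖f.coeff n‖ * s ^ n = (‖f.coeff n‖ * r ^ n) * (s / r) ^ n := by
        rw [div_pow]; field_simp
    _ ≤ r * (s / r) ^ n := by gcongr; exact hf n

theorem SelfBounded.convergesAt {f : L⟦X⟧} {r : ℝ} (hf : SelfBounded f r) {x : L}
    (hx : ‖x‖ < r) : ConvergesAt f x :=
  convergesAt_of_tendsto (hf.tendsto (norm_nonneg x) hx)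

omit [CompleteSpace L] in
theorem SelfBounded.norm_evalAt_le {f : L⟦X⟧} {x : L} (hf : SelfBounded f ‖x‖) :
    ‖evalAt f x‖ ≤ ‖x‖ :=
  IsUltrametricDist.norm_tsum_le_of_forall_le_of_nonneg (norm_nonneg _) fun n => by
    simpa using hf n

omit [CompleteSpace L] in
theorem hasSum_mul_antidiagonal {u v : ℕ → L} {s t : L} (hu : HasSum u s) (hv : HasSum v t) :
    HasSum (fun n => ∑ q ∈ HasAntidiagonal.antidiagonal n, u q.1 * v q.2) (s * t) := by
  have : NonarchimedeanRing L :=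
    { is_nonarchimedean := NonarchimedeanAddGroup.is_nonarchimedean }
  have hprod := hu.summable.mul_of_nonarchimedean hv.summable
  have h := (summable_sum_mul_antidiagonal_of_summable_mul hprod).hasSum
  rwa [← hu.summable.tsum_mul_tsum_eq_tsum_sum_antidiagonal hv.summable hprod, hu.tsum_eq,
    hv.tsum_eq] at h

omit [CompleteSpace L] in
theorem ConvergesAt.hasSum_pow {f : L⟦X⟧} {x : L} (hf : ConvergesAt f x) (l : ℕ) :
    HasSum (fun k => (f ^ l).coeff k * x ^ k) (evalAt f x ^ l) := by
  induction l with
  | zero =>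
    have := hasSum_single (f := fun k => ((f ^ 0).coeff k) * x ^ k) 0
      (fun k hk => by simp [coeff_one, hk])
    simpa using this
  | succ l ih =>
    have hf' : HasSum (fun k => f.coeff k * x ^ k) (evalAt f x) := Summable.hasSum hf
    rw [pow_succ (evalAt f x)]
    convert! hasSum_mul_antidiagonal ih hf' using 2 with n
    rw [pow_succ f, coeff_mul, sum_mul]
    refine sum_congr rfl fun q hq => ?_
    rw [← HasAntidiagonal.mem_antidiagonal.1 hq]
    ring

/-- In a complete ultrametric field, a double series whose rows converge and are bounded by a null
sequence may be summed in either order. -/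
theorem hasSum_comm_of_tendsto {T : ℕ × ℕ → L} {B : ℕ → ℝ} {r c : ℕ → L}
    (hB : Tendsto B atTop (𝓝 0)) (hTB : ∀ q, ‖T q‖ ≤ B q.1)
    (hrow : ∀ l, HasSum (fun k => T (l, k)) (r l))
    (hcol : ∀ k, HasSum (fun l => T (l, k)) (c k)) : ∃ s, HasSum r s ∧ HasSum c s := by
  have hT : Summable T := by
    refine NonarchimedeanAddGroup.summable_of_tendsto_cofinite_zero ?_
    refine tendsto_zero_iff_norm_tendsto_zero.2 (Metric.tendsto_nhds.2 fun ε hε => ?_)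
    have hA : {l : ℕ | ¬ B l < ε}.Finite := by
      have := hB.eventually (gt_mem_nhds hε)
      rwa [← Nat.cofinite_eq_atTop] at this
    have hrows : ∀ l, {k : ℕ | ¬ ‖T (l, k)‖ < ε}.Finite := fun l =>
      (hrow l).summable.tendsto_cofinite_zero.norm.eventually (gt_mem_nhds (by simpa using hε))
    refine (hA.biUnion fun l _ => (hrows l).image (Prod.mk l)).subset ?_
    rintro ⟨l, k⟩ hlk
    have hlk' : ¬ ‖T (l, k)‖ < ε := by simpa using hlk
    simp only [Set.mem_iUnion]
    exact ⟨l, fun h => hlk' ((hTB _).trans_lt h), k, hlk', rfl⟩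
  have hswap : HasSum (fun q : ℕ × ℕ => T q.swap) (∑' q, T q) :=
    (Equiv.prodComm ℕ ℕ).hasSum_iff.2 hT.hasSum
  exact ⟨∑' q, T q, hT.hasSum.prod_fiberwise hrow, hswap.prod_fiberwise hcol⟩

/-- Evaluation is compatible with composition at `x` when `f` has Gauss norm at most `‖x‖` at
radius `‖x‖`. -/
theorem evalAt_subst {f g : L⟦X⟧} {x : L} (h0 : f.coeff 0 = 0) (hf : SelfBounded f ‖x‖)
    (hfx : ConvergesAt f x) (hgx : ConvergesAt g x) :
    ConvergesAt g (evalAt f x) ∧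
      evalAt g (evalAt f x) = evalAt (PowerSeries.subst f g : L⟦X⟧) x := by
  obtain ⟨s, h1, h2⟩ := hasSum_comm_of_tendsto
    (T := fun q => g.coeff q.1 * ((f ^ q.1).coeff q.2 * x ^ q.2))
    (r := fun l => g.coeff l * evalAt f x ^ l)
    (c := fun k => PowerSeries.coeff k (PowerSeries.subst f g) * x ^ k) hgx.tendsto
    (fun q => by
      rw [norm_mul, norm_mul, norm_pow]
      exact mul_le_mul_of_nonneg_left (hf.pow (norm_nonneg x) _ _) (norm_nonneg _))
    (fun l => (hfx.hasSum_pow l).mul_left _)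
    (fun k => by
      rw [coeff_subst_eq_sum h0, sum_mul]
      simp only [← mul_assoc]
      exact hasSum_sum_of_ne_finset_zero fun l hl => by
        rw [coeff_pow_eq_zero_of_lt h0 (by simpa using hl : k < l), mul_zero, zero_mul])
  exact ⟨h1.summable, h1.tsum_eq.trans h2.tsum_eq.symm⟩

end Evaluation

/-! ### Series whose nonlinear part is a series in `x ^ p` -/

section Inseparable

open PowerSeries Finset Filter Topology

variable {p : ℕ} [Fact p.Prime] {L : Type*} [NontriviallyNormedField L] [CharP L p]

theorem norm_pow_sub_pow_le [IsUltrametricDist L] {x y : L} {r : ℝ} (hx : ‖x‖ ≤ r)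
    (hy : ‖y‖ ≤ r) (j : ℕ) : ‖x ^ (j + 1) - y ^ (j + 1)‖ ≤ r ^ j * ‖x - y‖ := by
  have hr : 0 ≤ r := (norm_nonneg x).trans hx
  rw [← geom_sum₂_mul, norm_mul]
  gcongr
  refine IsUltrametricDist.norm_sum_le_of_forall_le_of_nonneg (by positivity) fun i hi => ?_
  rw [norm_mul, norm_pow, norm_pow]
  have hij : i + (j + 1 - 1 - i) = j := by have := mem_range.1 hi; omega
  calc ‖x‖ ^ i * ‖y‖ ^ (j + 1 - 1 - i) ≤ r ^ i * r ^ (j + 1 - 1 - i) := by gcongr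
    _ = r ^ j := by rw [← pow_add, hij]

/-- In characteristic `p` a difference of `p`-th powers is the `p`-th power of a difference, so a
series in `x` and `x ^ p` is linear up to an error of order `p`. -/
theorem norm_evalAt_sub_sub_le [IsUltrametricDist L] {F : L⟦X⟧} {r : ℝ} (hr : 0 < r)
    (hF : SelfBounded F r) (hFp : ∀ i, 2 ≤ i → ¬ p ∣ i → F.coeff i = 0) {x y : L}
    (hx : ‖x‖ ≤ r) (hy : ‖y‖ ≤ r) (hFx : ConvergesAt F x) (hFy : ConvergesAt F y) :
    ‖evalAt F x - evalAt F y - F.coeff 1 * (x - y)‖ ≤ r * (‖x - y‖ / r) ^ p := by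
  have hp : 0 < p := (Fact.out : p.Prime).pos
  have hs := (hFx.hasSum.sub hFy.hasSum).sub
    (hasSum_ite_eq 1 (F.coeff 1 * (x - y)))
  change ‖(∑' n, F.coeff n * x ^ n) - (∑' n, F.coeff n * y ^ n) - F.coeff 1 * (x - y)‖ ≤ _
  rw [← hs.tsum_eq]
  refine IsUltrametricDist.norm_tsum_le_of_forall_le_of_nonneg (by positivity) fun i => ?_
  rcases Nat.lt_or_ge i 2 with hi | hi
  · interval_cases i
    · simp; positivity
    · simp [mul_sub]; positivity
  rw [if_neg (by omega), sub_zero, ← mul_sub]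
  by_cases hpi : p ∣ i
  · obtain ⟨j, rfl⟩ := hpi
    obtain ⟨j, rfl⟩ : ∃ n, j = n + 1 := ⟨j - 1, by
      have : j ≠ 0 := by rintro rfl; simp at hi
      omega⟩
    have hpow : x ^ (p * (j + 1)) - y ^ (p * (j + 1)) = (x ^ (j + 1) - y ^ (j + 1)) ^ p := by
      rw [sub_pow_char, ← pow_mul, ← pow_mul, mul_comm p]
    rw [norm_mul, hpow, norm_pow]
    calc ‖F.coeff (p * (j + 1))‖ * ‖x ^ (j + 1) - y ^ (j + 1)‖ ^ p
        ≤ ‖F.coeff (p * (j + 1))‖ * (r ^ j * ‖x - y‖) ^ p := by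
          gcongr; exact norm_pow_sub_pow_le hx hy j
      _ = (‖F.coeff (p * (j + 1))‖ * r ^ (p * (j + 1))) * (‖x - y‖ / r) ^ p := by
          rw [div_pow, mul_pow, ← pow_mul, mul_add, pow_add, mul_one, mul_comm j p]
          field_simp
      _ ≤ r * (‖x - y‖ / r) ^ p := by gcongr; exact hF _
  · rw [hFp i hi hpi, zero_mul, norm_zero]; positivity

theorem hasDerivAt_evalAt [IsUltrametricDist L] [CompleteSpace L] {F : L⟦X⟧} {r : ℝ}
    (hF : SelfBounded F r) (hFp : ∀ i, 2 ≤ i → ¬ p ∣ i → F.coeff i = 0) {x : L} (hx : ‖x‖ < r) :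
    HasDerivAt (evalAt F) (F.coeff 1) x := by
  have hr : 0 < r := (norm_nonneg x).trans_lt hx
  rw [hasDerivAt_iff_isLittleO]
  refine Asymptotics.IsBigO.trans_isLittleO ?_
    (Asymptotics.isLittleO_pow_sub_sub x (Fact.out : p.Prime).one_lt)
  refine Asymptotics.IsBigO.of_bound (r / r ^ p) ?_
  have hnhds : ∀ᶠ y in 𝓝 x, ‖y‖ < r := (continuous_norm.tendsto x).eventually (gt_mem_nhds hx)
  filter_upwards [hnhds] with y hy
  have := norm_evalAt_sub_sub_le hr hF hFp hy.le hx.le (hF.convergesAt hy) (hF.convergesAt hx)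
  rw [smul_eq_mul, mul_comm (y - x)]
  refine this.trans_eq ?_
  rw [norm_pow, norm_norm, div_pow]
  ring

end Inseparable

/-! ### The divisors `1 - λ ^ n` -/

section SmallDivisors

open Finset

variable {L : Type*} [NormedField L] [IsUltrametricDist L] {lam : L}

theorem norm_add_eq_left {x y : L} (h : ‖y‖ < ‖x‖) : ‖x + y‖ = ‖x‖ := by
  rw [IsUltrametricDist.norm_add_eq_max_of_norm_ne_norm h.ne', max_eq_left h.le]

theorem norm_eq_one_of_norm_one_sub_pow_lt_one
    (hm : ∃ n : ℕ, 1 ≤ n ∧ ‖1 - lam ^ n‖ < 1) : ‖lam‖ = 1 := by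
  obtain ⟨n, hn, h⟩ := hm
  have h1 : ‖(1 : L) + -(1 - lam ^ n)‖ = ‖(1 : L)‖ := norm_add_eq_left (by rwa [norm_neg, norm_one])
  have h2 : ‖lam‖ ^ n = 1 := by
    rw [← norm_pow, ← norm_one (α := L), ← h1]; congr 1; ring
  exact (pow_eq_one_iff_of_nonneg (norm_nonneg _) (by omega)).1 h2

omit [IsUltrametricDist L] in
theorem mIdx_spec (hm : ∃ n : ℕ, 1 ≤ n ∧ ‖1 - lam ^ n‖ < 1) :
    1 ≤ mIdx lam ∧ ‖1 - lam ^ mIdx lam‖ < 1 :=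
  Nat.sInf_mem (s := {n : ℕ | 1 ≤ n ∧ ‖1 - lam ^ n‖ < 1}) hm

theorem norm_one_sub_le_one {x : L} (hx : ‖x‖ = 1) : ‖1 - x‖ ≤ 1 := by
  rw [sub_eq_add_neg]
  exact (IsUltrametricDist.norm_add_le_max _ _).trans (by simp [hx])

theorem norm_one_sub_pow_le {x : L} (hx : ‖x‖ = 1) (j : ℕ) : ‖1 - x ^ j‖ ≤ ‖1 - x‖ := by
  rw [← mul_neg_geom_sum, norm_mul]
  refine mul_le_of_le_one_right (norm_nonneg _) ?_
  exact IsUltrametricDist.norm_sum_le_of_forall_le_of_nonneg zero_le_one fun i _ => by simp [hx]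

theorem norm_one_sub_pow_lt_one_iff (hm : ∃ n : ℕ, 1 ≤ n ∧ ‖1 - lam ^ n‖ < 1) (n : ℕ) :
    ‖1 - lam ^ n‖ < 1 ↔ mIdx lam ∣ n := by
  have hlam := norm_eq_one_of_norm_one_sub_pow_lt_one hm
  have hlamj : ∀ j, ‖lam ^ j‖ = 1 := fun j => by rw [norm_pow, hlam, one_pow]
  obtain ⟨hm1, hm2⟩ := mIdx_spec hm
  have hmul : ∀ j, ‖1 - lam ^ (mIdx lam * j)‖ < 1 := fun j => by
    rw [pow_mul]; exact (norm_one_sub_pow_le (hlamj _) j).trans_lt hm2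
  refine ⟨fun h => ?_, fun ⟨j, hj⟩ => hj ▸ hmul j⟩
  rw [Nat.dvd_iff_mod_eq_zero]
  by_contra hr
  have hrm : n % mIdx lam < mIdx lam := Nat.mod_lt _ hm1
  refine Nat.notMem_of_lt_sInf (s := {n : ℕ | 1 ≤ n ∧ ‖1 - lam ^ n‖ < 1}) hrm
    ⟨by omega, ?_⟩
  have e : lam ^ (mIdx lam * (n / mIdx lam)) * (1 - lam ^ (n % mIdx lam)) =
      (1 - lam ^ n) + -(1 - lam ^ (mIdx lam * (n / mIdx lam))) := by
    rw [mul_sub, ← pow_add, Nat.div_add_mod]; ring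
  rw [← one_mul ‖1 - lam ^ (n % mIdx lam)‖, ← hlamj (mIdx lam * (n / mIdx lam)), ← norm_mul, e]
  refine (IsUltrametricDist.norm_add_le_max _ _).trans_lt ?_
  rw [hlamj, norm_neg]
  exact max_lt h (hmul _)

variable {p : ℕ} [Fact p.Prime] [CharP L p]

omit [IsUltrametricDist L] in
theorem norm_natCast_eq_one_of_not_dvd {s : ℕ} (hs : ¬ p ∣ s) : ‖(s : L)‖ = 1 := by
  have hp := (Fact.out : p.Prime)
  have h0 : (s : L) ≠ 0 := fun h => hs ((CharP.cast_eq_zero_iff L p s).1 h)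
  have h1 : (s : L) ^ p = s := map_natCast (frobenius L p) s
  have h2 : (s : L) ^ (p - 1) = 1 := by
    refine mul_right_cancel₀ h0 ?_
    rw [← pow_succ, Nat.sub_add_cancel hp.one_le, h1, one_mul]
  have h3 : ‖(s : L)‖ ^ (p - 1) = 1 := by rw [← norm_pow, h2, norm_one]
  exact (pow_eq_one_iff_of_nonneg (norm_nonneg _) (by have := hp.two_le; omega)).1 h3

/-- Raising `y` close to `1` to a power prime to the residue characteristic does not change the
distance to `1`. -/
theorem norm_one_sub_pow_eq {y : L} (hy : ‖1 - y‖ < 1) {s : ℕ} (hs : ¬ p ∣ s) :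
    ‖1 - y ^ s‖ = ‖1 - y‖ := by
  have hy1 : ‖y‖ = 1 :=
    norm_eq_one_of_norm_one_sub_pow_lt_one ⟨1, le_rfl, by simpa using hy⟩
  have e : ∑ i ∈ range s, y ^ i = (s : L) + ∑ i ∈ range s, (y ^ i - 1) := by
    simp
  have hlt : ‖∑ i ∈ range s, (y ^ i - 1)‖ ≤ ‖1 - y‖ :=
    IsUltrametricDist.norm_sum_le_of_forall_le_of_nonneg (norm_nonneg _) fun i _ => by
      rw [norm_sub_rev]; exact norm_one_sub_pow_le hy1 i
  have hs1 := norm_natCast_eq_one_of_not_dvd (L := L) hs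
  rw [← mul_neg_geom_sum, norm_mul, e, norm_add_eq_left (by rw [hs1]; exact hlt.trans_lt hy), hs1,
    mul_one]

theorem coprime_mIdx (p : ℕ) [Fact p.Prime] [CharP L p]
    (hm : ∃ n : ℕ, 1 ≤ n ∧ ‖1 - lam ^ n‖ < 1) : p.Coprime (mIdx lam) := by
  have hp := (Fact.out : p.Prime)
  rw [hp.coprime_iff_not_dvd]
  rintro ⟨j, hj⟩
  obtain ⟨hm1, hm2⟩ := mIdx_spec hm
  have hj0 : 0 < j := Nat.pos_of_ne_zero (by rintro rfl; omega)
  have h : ‖1 - lam ^ j‖ < 1 := by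
    have e : (1 - lam ^ j) ^ p = 1 - lam ^ mIdx lam := by
      rw [sub_pow_char, one_pow, ← pow_mul, mul_comm j, hj]
    rw [← e, norm_pow] at hm2
    exact (pow_lt_one_iff_of_nonneg (norm_nonneg _) hp.ne_zero).1 hm2
  have := Nat.le_of_dvd hj0 ((norm_one_sub_pow_lt_one_iff hm j).1 h)
  have := Nat.mul_lt_mul_of_pos_right hp.one_lt hj0
  omega

theorem kPrime_spec (p : ℕ) [Fact p.Prime] [CharP L p]
    (hm : ∃ n : ℕ, 1 ≤ n ∧ ‖1 - lam ^ n‖ < 1) :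
    1 ≤ kPrime p lam ∧ p ∣ kPrime p lam ∧ mIdx lam ∣ kPrime p lam - 1 := by
  refine Nat.sInf_mem (s := {k : ℕ | 1 ≤ k ∧ p ∣ k ∧ mIdx lam ∣ k - 1}) ?_
  have hp := (Fact.out : p.Prime)
  have hm1 := (mIdx_spec hm).1
  obtain ⟨k, hk1, hk2⟩ := Nat.chineseRemainder (coprime_mIdx p hm) 0 1
  have hpos : 1 ≤ k + p * mIdx lam := by
    have := Nat.mul_pos hp.pos hm1; omega
  refine ⟨k + p * mIdx lam, hpos, ?_, ?_⟩
  · exact dvd_add ((Nat.modEq_zero_iff_dvd).1 hk1) (dvd_mul_right _ _)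
  · refine (Nat.modEq_iff_dvd' hpos).1 ?_
    have : k + p * mIdx lam ≡ 1 + 0 [MOD mIdx lam] :=
      hk2.add ((Nat.modEq_zero_iff_dvd).2 (dvd_mul_left _ _))
    exact this.symm

theorem two_le_kPrime (hm : ∃ n : ℕ, 1 ≤ n ∧ ‖1 - lam ^ n‖ < 1) : 2 ≤ kPrime p lam := by
  obtain ⟨h1, h2, -⟩ := kPrime_spec p hm
  exact (Fact.out : p.Prime).two_le.trans (Nat.le_of_dvd h1 h2)

theorem kPrime_le_mul (hm : ∃ n : ℕ, 1 ≤ n ∧ ‖1 - lam ^ n‖ < 1) :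
    kPrime p lam ≤ mIdx lam * p := by
  obtain ⟨h1, h2, h3⟩ := kPrime_spec p hm
  by_contra! hlt
  have hpos : 0 < mIdx lam * p := Nat.mul_pos (mIdx_spec hm).1 (Fact.out : p.Prime).pos
  refine Nat.notMem_of_lt_sInf (s := {k : ℕ | 1 ≤ k ∧ p ∣ k ∧ mIdx lam ∣ k - 1})
    (m := kPrime p lam - mIdx lam * p) (Nat.sub_lt h1 hpos) ⟨by omega, ?_, ?_⟩
  · exact Nat.dvd_sub h2 (dvd_mul_left _ _)
  · rw [Nat.sub_right_comm]
    exact Nat.dvd_sub h3 (dvd_mul_right _ _)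

theorem exists_eq_kPrime_add (hm : ∃ n : ℕ, 1 ≤ n ∧ ‖1 - lam ^ n‖ < 1) {k : ℕ} (hk : 1 ≤ k)
    (hpk : p ∣ k) (hmk : mIdx lam ∣ k - 1) : ∃ j, k = kPrime p lam + mIdx lam * p * j := by
  obtain ⟨h1, h2, h3⟩ := kPrime_spec p hm
  have hle : kPrime p lam ≤ k := Nat.sInf_le ⟨hk, hpk, hmk⟩
  have hd1 : p ∣ k - kPrime p lam := Nat.dvd_sub hpk h2
  have hd2 : mIdx lam ∣ k - kPrime p lam := by
    have := Nat.dvd_sub hmk h3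
    rwa [show k - 1 - (kPrime p lam - 1) = k - kPrime p lam by omega] at this
  obtain ⟨j, hj⟩ := (coprime_mIdx p hm).symm.mul_dvd_of_dvd_of_dvd hd2 hd1
  exact ⟨j, by omega⟩

omit [IsUltrametricDist L] in
theorem norm_sub_pow_eq (hlam : ‖lam‖ = 1) {k : ℕ} (hk : 1 ≤ k) :
    ‖lam - lam ^ k‖ = ‖1 - lam ^ (k - 1)‖ := by
  obtain ⟨n, rfl⟩ : ∃ n, k = n + 1 := ⟨k - 1, by omega⟩
  rw [show lam - lam ^ (n + 1) = lam * (1 - lam ^ n) by ring, norm_mul, hlam, one_mul,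
    Nat.add_sub_cancel]

theorem norm_sub_pow_of_not_dvd (hm : ∃ n : ℕ, 1 ≤ n ∧ ‖1 - lam ^ n‖ < 1) {k : ℕ} (hk : 1 ≤ k)
    (hmk : ¬ mIdx lam ∣ k - 1) : ‖lam - lam ^ k‖ = 1 := by
  have hlam := norm_eq_one_of_norm_one_sub_pow_lt_one hm
  rw [norm_sub_pow_eq hlam hk]
  rw [← norm_one_sub_pow_lt_one_iff hm, not_lt] at hmk
  exact le_antisymm (norm_one_sub_le_one (by rw [norm_pow, hlam, one_pow])) hmk

/-- All the small divisors at indices divisible by `p` have the same absolute value, because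
`k - 1` is then prime to `p`. -/
theorem norm_sub_pow_of_dvd (hm : ∃ n : ℕ, 1 ≤ n ∧ ‖1 - lam ^ n‖ < 1) {k : ℕ} (hk : 1 ≤ k)
    (hpk : p ∣ k) (hmk : mIdx lam ∣ k - 1) : ‖lam - lam ^ k‖ = ‖1 - lam ^ mIdx lam‖ := by
  rw [norm_sub_pow_eq (norm_eq_one_of_norm_one_sub_pow_lt_one hm) hk]
  obtain ⟨s, hs⟩ := hmk
  rw [hs, pow_mul]
  refine norm_one_sub_pow_eq (p := p) (mIdx_spec hm).2 fun hps => ?_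
  have h1 : p ∣ k - 1 := hs ▸ Dvd.dvd.mul_left hps _
  have h2 : p ∣ k - (k - 1) := Nat.dvd_sub hpk h1
  rw [Nat.sub_sub_self hk] at h2
  exact (Fact.out : p.Prime).one_lt.ne' (Nat.dvd_one.1 h2)

end SmallDivisors

/-! ### Counting small divisors -/

section Counting

/-- The number of indices `j ≤ k` of the form `j = d + M * i`, for `d ≤ M`. -/
def countAP (d M k : ℕ) : ℕ := (k + (M - d)) / M

variable {d M : ℕ}

theorem countAP_mono : Monotone (countAP d M) := fun _ _ h =>
  Nat.div_le_div_right (Nat.add_le_add_right h _)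

theorem countAP_one (hd : 2 ≤ d) (hdM : d ≤ M) : countAP d M 1 = 0 :=
  Nat.div_eq_of_lt (by omega)

theorem countAP_self (hd : 2 ≤ d) (hdM : d ≤ M) : countAP d M d = 1 := by
  rw [countAP, Nat.add_sub_cancel' hdM, Nat.div_self (by omega)]

theorem countAP_lt (hd : 2 ≤ d) (hdM : d ≤ M) {j l : ℕ} (hl : l < d + M * j) :
    countAP d M l + 1 ≤ countAP d M (d + M * j) := by
  have hM : 0 < M := by omega
  have e : countAP d M (d + M * j) = j + 1 := by
    rw [countAP, show d + M * j + (M - d) = M * (j + 1) by rw [mul_add]; omega,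
      Nat.mul_div_cancel_left _ hM]
  rw [e, Nat.succ_le_iff, countAP, Nat.div_lt_iff_lt_mul hM, add_mul, one_mul, mul_comm j]
  omega

theorem mul_countAP_lt (hd : 2 ≤ d) (hdM : d ≤ M) {k : ℕ} (hk : 2 ≤ k) (hkd : k ≠ d) :
    (d - 1) * countAP d M k < k - 1 := by
  have h := Nat.div_mul_le_self (k + (M - d)) M
  change countAP d M k * M ≤ _ at h
  generalize countAP d M k = n at h
  obtain ⟨d, rfl⟩ : ∃ c, d = c + 1 := ⟨d - 1, by omega⟩
  obtain ⟨t, rfl⟩ : ∃ t, M = d + 1 + t := ⟨M - (d + 1), by omega⟩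
  rcases n with _ | _ | n
  · omega
  · simp only [Nat.add_sub_cancel]; omega
  · simp only [Nat.add_sub_cancel]
    have e : (n + 1 + 1) * (d + 1 + t) = d * (n + 1 + 1) + n + 2 + (n + 1) * t + t := by ring
    omega

theorem le_mul_sub_countAP (hd : 2 ≤ d) (hdM : d ≤ M) (k : ℕ) :
    k ≤ M * ((k - 1) - (d - 1) * countAP d M k) + M * d := by
  have h := Nat.div_mul_le_self (k + (M - d)) M
  change countAP d M k * M ≤ _ at h
  rcases Nat.lt_or_ge k 2 with hk | hk
  · have : 2 * 2 ≤ M * d := Nat.mul_le_mul (by omega) hd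
    omega
  rcases eq_or_ne k d with rfl | hkd
  · exact Nat.le_add_left_of_le (Nat.le_mul_of_pos_left _ (by omega))
  have hlt := mul_countAP_lt hd hdM hk hkd
  generalize countAP d M k = n at h hlt
  obtain ⟨c, rfl⟩ : ∃ c, d = c + 1 := ⟨d - 1, by omega⟩
  obtain ⟨t, rfl⟩ : ∃ t, M = c + 1 + t := ⟨M - (c + 1), by omega⟩
  obtain ⟨k, rfl⟩ : ∃ i, k = i + 1 := ⟨k - 1, by omega⟩
  simp only [Nat.add_sub_cancel] at hlt ⊢
  obtain ⟨e, rfl⟩ : ∃ e, k = c * n + e := ⟨k - c * n, by omega⟩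
  rw [Nat.add_sub_cancel_left]
  have h' : n * (c + 1 + t) ≤ c * n + e + 1 + t := by omega
  have hn : n * (1 + t) ≤ e + 1 + t := by nlinarith
  have hcn : c * n ≤ c * (e + 1 + t) := Nat.mul_le_mul_left _ (by nlinarith)
  nlinarith

end Counting

/-! ### The coefficients of the conjugacy -/

section Estimates

open PowerSeries Finset Filter Topology

theorem norm_sum_lt_of_forall_lt {L ι : Type*} [NormedField L] [IsUltrametricDist L]
    {s : Finset ι} {u : ι → L} {C : ℝ} (hC : 0 < C) (h : ∀ i ∈ s, ‖u i‖ < C) :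
    ‖∑ i ∈ s, u i‖ < C := by
  rcases s.eq_empty_or_nonempty with rfl | hs
  · simpa using hC
  · obtain ⟨i, hi, hle⟩ := IsUltrametricDist.exists_norm_finsetSum_le_of_nonempty hs u
    exact hle.trans_lt (h i hi)

variable {L : Type*} [NontriviallyNormedField L] [IsUltrametricDist L]

theorem norm_coeff_mul_coeff_pow_le {f g : L⟦X⟧} {r : ℝ} (hr : 0 ≤ r) (hf : SelfBounded f r)
    (l k : ℕ) : ‖g.coeff l * (f ^ l).coeff k‖ * r ^ k ≤ ‖g.coeff l‖ * r ^ l := by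
  rw [norm_mul, mul_assoc]
  exact mul_le_mul_of_nonneg_left (hf.pow hr l k) (norm_nonneg _)

/-- The coefficient of index `k` of the conjugacy loses one factor `δ` for each small divisor of
index at most `k`; the function `N` counts these. -/
theorem norm_coeff_conjugacy_le {f g : L⟦X⟧} {r δ : ℝ} {N : ℕ → ℕ} (hr : 0 < r) (hδ0 : 0 < δ)
    (hδ1 : δ ≤ 1) (hN : Monotone N) (hN1 : N 1 = 0) (h0 : f.coeff 0 = 0)
    (hf : SelfBounded f r) (hg : IsFormalConjugacy f g)
    (hdiv : ∀ k, 2 ≤ k → g.coeff k = 0 ∨ ‖f.coeff 1 - f.coeff 1 ^ k‖ = 1 ∨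
      (‖f.coeff 1 - f.coeff 1 ^ k‖ = δ ∧ ∀ l < k, N l + 1 ≤ N k)) (k : ℕ) :
    ‖g.coeff k‖ * r ^ k * δ ^ N k ≤ r := by
  induction k using Nat.strong_induction_on with
  | _ k ih =>
    rcases Nat.lt_or_ge k 2 with hk | hk
    · interval_cases k
      · simp [hg.1, hr.le]
      · simp [hg.2.1, hN1]
    have hkr : 0 < r ^ k := pow_pos hr k
    -- it suffices to bound each summand of the recursion, with the current divisor taken out
    have key : ∀ n : ℕ, (∀ l < k, N l ≤ n) →
        ‖g.coeff k‖ * ‖f.coeff 1 - f.coeff 1 ^ k‖ * r ^ k * δ ^ n ≤ r := fun n hn => by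
      rw [← norm_mul, coeff_conjugacy_mul h0 hg, mul_assoc, ← le_div_iff₀ (by positivity)]
      refine IsUltrametricDist.norm_sum_le_of_forall_le_of_nonneg (by positivity) fun l hl => ?_
      rw [mem_range] at hl
      rw [le_div_iff₀ (by positivity), ← mul_assoc]
      calc ‖g.coeff l * (f ^ l).coeff k‖ * r ^ k * δ ^ n
          ≤ ‖g.coeff l‖ * r ^ l * δ ^ N l :=
            mul_le_mul (norm_coeff_mul_coeff_pow_le hr.le hf l k)
              (pow_le_pow_of_le_one hδ0.le hδ1 (hn l hl)) (by positivity) (by positivity)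
        _ ≤ r := ih l hl
    rcases hdiv k hk with h | h | ⟨h, hNk⟩
    · simp [h, hr.le]
    · have := key (N k) fun l hl => hN hl.le
      rwa [h, mul_one] at this
    · obtain ⟨n, hn⟩ : ∃ n, N k = n + 1 := ⟨N k - 1, by have := hNk 0 (by omega); omega⟩
      have := key n fun l hl => by have := hNk l hl; omega
      rw [h] at this
      rw [hn, pow_succ]
      linarith

/-- Below the first small divisor, strict bounds on the coefficients of `f` pass to `g`. -/
theorem norm_coeff_conjugacy_lt {f g : L⟦X⟧} {r : ℝ} {d : ℕ} (hr : 0 < r) (h0 : f.coeff 0 = 0)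
    (hf : SelfBounded f r) (hg : IsFormalConjugacy f g)
    (hlt : ∀ i, 2 ≤ i → i < d → ‖f.coeff i‖ * r ^ i < r)
    (hdiv : ∀ k, 2 ≤ k → k < d → g.coeff k = 0 ∨ ‖f.coeff 1 - f.coeff 1 ^ k‖ = 1) :
    ∀ k, 2 ≤ k → k < d → ‖g.coeff k‖ * r ^ k < r := by
  intro k
  induction k using Nat.strong_induction_on with
  | _ k ih =>
    intro hk hkd
    rcases hdiv k hk hkd with h | h
    · simpa [h] using hr
    rw [← mul_one ‖g.coeff k‖, ← h, ← norm_mul, coeff_conjugacy_mul h0 hg,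
      ← lt_div_iff₀ (pow_pos hr k)]
    refine norm_sum_lt_of_forall_lt (by positivity) fun l hl => ?_
    rw [mem_range] at hl
    rw [lt_div_iff₀ (pow_pos hr k)]
    rcases Nat.lt_or_ge l 2 with h2 | h2
    · interval_cases l
      · simpa [hg.1] using hr
      · simpa [hg.2.1] using hlt k hk hkd
    · exact (norm_coeff_mul_coeff_pow_le hr.le hf l k).trans_lt (ih l hl h2 (hl.trans hkd))

/-- At the first small divisor the leading term of the recursion is `f.coeff d`, which dominates. -/
theorem norm_coeff_conjugacy_eq {f g : L⟦X⟧} {r : ℝ} {d : ℕ} (hd : 2 ≤ d) (hr : 0 < r)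
    (h0 : f.coeff 0 = 0) (hf : SelfBounded f r) (hg : IsFormalConjugacy f g)
    (hfd : ‖f.coeff d‖ * r ^ d = r) (hgd : ∀ k, 2 ≤ k → k < d → ‖g.coeff k‖ * r ^ k < r) :
    ‖g.coeff d‖ * ‖f.coeff 1 - f.coeff 1 ^ d‖ * r ^ d = r := by
  have hrd : 0 < r ^ d := pow_pos hr d
  have hfd' : ‖f.coeff d‖ = r / r ^ d := by rw [eq_div_iff hrd.ne', hfd]
  rw [← norm_mul, coeff_conjugacy_mul h0 hg,
    ← add_sum_erase (range d) _ (mem_range.2 (by omega : 1 < d)), hg.2.1, one_mul, pow_one,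
    norm_add_eq_left, hfd]
  rw [hfd']
  refine norm_sum_lt_of_forall_lt (by positivity) fun l hl => ?_
  rw [mem_erase, mem_range] at hl
  rw [lt_div_iff₀ hrd]
  rcases Nat.eq_zero_or_pos l with rfl | hl0
  · simpa [hg.1] using hr
  · exact (norm_coeff_mul_coeff_pow_le hr.le hf l d).trans_lt (hgd l (by omega) hl.2)

end Estimates

/-! ### Conjugacies with a critical radius -/

section Data

open PowerSeries Filter Topology

/-- The properties of a series `f` and its conjugacy `g` from which the linearization disc is
determined: on the closed disc of radius `σ` the series `f` is an isometry, while the Gauss norm of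
`g` is attained exactly at the indices `1` and `d`. The nonlinear parts are series in `x ^ p`. -/
structure CriticalConjugacy {L : Type*} [NontriviallyNormedField L] (p : ℕ) (f g : L⟦X⟧)
    (σ : ℝ) (d : ℕ) : Prop where
  coeff_zero : f.coeff 0 = 0
  norm_coeff_one : ‖f.coeff 1‖ = 1
  coeff_eq_zero : ∀ i, 2 ≤ i → ¬ p ∣ i → f.coeff i = 0
  conj : IsFormalConjugacy f g
  unique : ∀ g' : L⟦X⟧, IsFormalConjugacy f g' → g' = g
  conj_coeff_eq_zero : ∀ i, 2 ≤ i → ¬ p ∣ i → g.coeff i = 0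
  radius_pos : 0 < σ
  exists_radius : ∃ r, σ < r ∧ SelfBounded f r
  two_le : 2 ≤ d
  norm_coeff_eq : ‖g.coeff d‖ * σ ^ d = σ
  exists_norm_coeff_le : ∃ τ < 1, 0 ≤ τ ∧
    ∀ k, 2 ≤ k → k ≠ d → ‖g.coeff k‖ * σ ^ k ≤ σ * τ
  tendsto_zero : Tendsto (fun k => ‖g.coeff k‖ * σ ^ k) atTop (𝓝 0)

theorem rpow_one_div_natCast_sub_one {x : ℝ} (hx : 0 ≤ x) {i : ℕ} (hi : 2 ≤ i) :
    (x ^ (1 / ((i : ℝ) - 1))) ^ (i - 1) = x := by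
  have h := Real.rpow_inv_natCast_pow hx (n := i - 1) (by omega)
  rwa [Nat.cast_sub (by omega), Nat.cast_one, ← one_div] at h

theorem CriticalConjugacy.of_family {p : ℕ} [Fact p.Prime] {K : Type*} [NontriviallyNormedField K]
    [IsUltrametricDist K] [CharP K p] {lam : K} (hroot : ∀ n : ℕ, 1 ≤ n → lam ^ n ≠ 1)
    (hm : ∃ n : ℕ, 1 ≤ n ∧ ‖1 - lam ^ n‖ < 1) {a : ℝ} (ha : 0 < a) {f : K⟦X⟧}
    (hf : f ∈ family p lam a)
    (hk : a = ‖f.coeff (kPrime p lam)‖ ^ (1 / ((kPrime p lam : ℝ) - 1)))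
    (hlt : ∀ i : ℕ, 2 ≤ i → i < kPrime p lam → ‖f.coeff i‖ < a ^ (i - 1)) :
    ∃ g : K⟦X⟧, CriticalConjugacy p f g (sigma p lam a) (kPrime p lam) := by
  obtain ⟨h0, h1, hfp, hlub⟩ := hf
  have hlam := norm_eq_one_of_norm_one_sub_pow_lt_one hm
  have hlam0 : f.coeff 1 ≠ 0 := by rw [h1, ← norm_ne_zero_iff, hlam]; exact one_ne_zero
  have hroot' : ∀ n : ℕ, 1 ≤ n → f.coeff 1 ^ n ≠ 1 := by rwa [h1]
  obtain ⟨g, hg⟩ := exists_isFormalConjugacy h0 hlam0 hroot'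
  have hgp := hg.coeff_eq_zero h0 hlam0 hroot' hfp
  have hd2 : 2 ≤ kPrime p lam := two_le_kPrime hm
  have hdM : kPrime p lam ≤ mIdx lam * p := kPrime_le_mul hm
  obtain ⟨hk1, hkp, hkm⟩ := kPrime_spec p hm
  have hM : 0 < mIdx lam * p := by omega
  have hm1 := (mIdx_spec hm).1
  have hδ1 := (mIdx_spec hm).2
  have hδ0 : 0 < ‖1 - lam ^ mIdx lam‖ :=
    norm_pos_iff.2 (sub_ne_zero.2 (hroot _ hm1).symm)
  set d := kPrime p lam with hd
  set δ := ‖1 - lam ^ mIdx lam‖ with hδ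
  set N := countAP d (mIdx lam * p) with hNdef
  -- `τ = a σ` is the `(d - 1)`-st root of `δ`
  set τ : ℝ := δ ^ (1 / ((d : ℝ) - 1)) with hτ
  have hτd : τ ^ (d - 1) = δ := rpow_one_div_natCast_sub_one hδ0.le hd2
  have hτ0 : 0 < τ := Real.rpow_pos_of_pos hδ0 _
  have hτ1 : τ < 1 := by
    rw [← hτd] at hδ1
    exact (pow_lt_one_iff_of_nonneg hτ0.le (by omega)).1 hδ1
  have hr : 0 < a⁻¹ := inv_pos.2 ha
  have hσ : sigma p lam a = a⁻¹ * τ := by rw [sigma, div_eq_inv_mul]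
  have hai : ∀ i, 2 ≤ i → a ^ (i - 1) * a⁻¹ ^ i = a⁻¹ := fun i hi => by
    obtain ⟨n, rfl⟩ : ∃ n, i = n + 1 := ⟨i - 1, by omega⟩
    rw [Nat.add_sub_cancel, pow_succ, ← mul_assoc, ← mul_pow, mul_inv_cancel₀ ha.ne', one_pow,
      one_mul]
  have hfr : SelfBounded f a⁻¹ := fun i => by
    rcases Nat.lt_or_ge i 2 with hi | hi
    · interval_cases i
      · simp [h0, hr.le]
      · simp [h1, hlam]
    · have hle := hlub.1 ⟨i, hi, rfl⟩
      have := pow_le_pow_left₀ (by positivity) hle (i - 1)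
      rw [rpow_one_div_natCast_sub_one (norm_nonneg _) hi] at this
      exact (mul_le_mul_of_nonneg_right this (by positivity)).trans_eq (hai i hi)
  have hfd : ‖f.coeff d‖ * a⁻¹ ^ d = a⁻¹ := by
    have e : a ^ (d - 1) = ‖f.coeff d‖ := by
      rw [hk]
      exact rpow_one_div_natCast_sub_one (norm_nonneg _) hd2
    rw [← e, hai d hd2]
  have hflt : ∀ i, 2 ≤ i → i < d → ‖f.coeff i‖ * a⁻¹ ^ i < a⁻¹ := fun i hi hid => by
    conv_rhs => rw [← hai i hi]
    have := hlt i hi hid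
    gcongr
  have hbound : ∀ k, ‖g.coeff k‖ * a⁻¹ ^ k * δ ^ N k ≤ a⁻¹ := by
    refine norm_coeff_conjugacy_le hr hδ0 hδ1.le countAP_mono (countAP_one hd2 hdM) h0 hfr hg
      fun k hk2 => ?_
    by_cases hpk : p ∣ k
    · refine Or.inr ?_
      rw [h1]
      by_cases hmk : mIdx lam ∣ k - 1
      · refine Or.inr ⟨norm_sub_pow_of_dvd hm (by omega) hpk hmk, fun l hl => ?_⟩
        obtain ⟨j, rfl⟩ := exists_eq_kPrime_add hm (by omega) hpk hmk
        exact countAP_lt hd2 hdM hl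
      · exact Or.inl (norm_sub_pow_of_not_dvd hm (by omega) hmk)
    · exact Or.inl (hgp k hk2 hpk)
  have hglt : ∀ k, 2 ≤ k → k < d → ‖g.coeff k‖ * a⁻¹ ^ k < a⁻¹ := by
    refine norm_coeff_conjugacy_lt hr h0 hfr hg hflt fun k hk2 hkd => ?_
    by_cases hpk : p ∣ k
    · refine Or.inr ?_
      rw [h1]
      refine norm_sub_pow_of_not_dvd hm (by omega) fun hmk => ?_
      obtain ⟨j, hj⟩ := exists_eq_kPrime_add hm (by omega) hpk hmk
      omega
    · exact Or.inl (hgp k hk2 hpk)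
  have hgd := norm_coeff_conjugacy_eq hd2 hr h0 hfr hg hfd hglt
  rw [h1, norm_sub_pow_of_dvd hm hk1 hkp hkm] at hgd
  have hbound' : ∀ k, 1 ≤ k → (d - 1) * N k ≤ k - 1 →
      ‖g.coeff k‖ * sigma p lam a ^ k ≤ sigma p lam a * τ ^ (k - 1 - (d - 1) * N k) := by
    intro k hk1 hle
    have e : τ ^ k = δ ^ N k * τ ^ (k - 1 - (d - 1) * N k) * τ := by
      rw [← hτd, ← pow_mul, ← pow_add, Nat.add_sub_cancel' hle, ← pow_succ,
        Nat.sub_add_cancel hk1]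
    rw [hσ, mul_pow, e]
    calc ‖g.coeff k‖ * (a⁻¹ ^ k * (δ ^ N k * τ ^ (k - 1 - (d - 1) * N k) * τ))
        = (‖g.coeff k‖ * a⁻¹ ^ k * δ ^ N k) * (τ ^ (k - 1 - (d - 1) * N k) * τ) := by ring
      _ ≤ a⁻¹ * (τ ^ (k - 1 - (d - 1) * N k) * τ) := by gcongr; exact hbound k
      _ = a⁻¹ * τ * τ ^ (k - 1 - (d - 1) * N k) := by ring
  have hσ0 : 0 < sigma p lam a := by rw [hσ]; positivity
  have hNle : ∀ k, 2 ≤ k → (d - 1) * N k ≤ k - 1 := fun k hk2 => by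
    rcases eq_or_ne k d with rfl | hkd
    · rw [hNdef, countAP_self hd2 hdM, mul_one]
    · exact (mul_countAP_lt hd2 hdM hk2 hkd).le
  refine ⟨g, ⟨h0, by rw [h1, hlam], hfp, hg, fun g' hg' => hg.unique h0 hlam0 hroot' hg', hgp,
    hσ0, ⟨a⁻¹, by rw [hσ]; exact mul_lt_of_lt_one_right hr hτ1, hfr⟩, hd2, ?_,
    ⟨τ, hτ1, hτ0.le, fun k hk2 hkd => ?_⟩, ?_⟩⟩
  · have e : τ ^ d = δ * τ := by
      rw [← hτd, ← pow_succ, Nat.sub_add_cancel hk1]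
    rw [hσ, mul_pow, e]
    linear_combination τ * hgd
  · have hlt := mul_countAP_lt hd2 hdM hk2 hkd
    refine (hbound' k (by omega) hlt.le).trans (mul_le_mul_of_nonneg_left ?_ hσ0.le)
    exact pow_le_of_le_one hτ0.le hτ1.le (by change k - 1 - (d - 1) * countAP _ _ k ≠ 0; omega)
  · -- the exponent of `τ` grows linearly in `k`: compare with a geometric series in `ρ`
    set ρ : ℝ := τ ^ ((↑(mIdx lam * p) : ℝ)⁻¹) with hρ
    have hρM : ρ ^ (mIdx lam * p) = τ := Real.rpow_inv_natCast_pow hτ0.le hM.ne'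
    have hρ0 : 0 < ρ := Real.rpow_pos_of_pos hτ0 _
    have hρ1 : ρ < 1 := by
      rw [← hρM] at hτ1
      exact (pow_lt_one_iff_of_nonneg hρ0.le hM.ne').1 hτ1
    have hlim : Tendsto (fun k => sigma p lam a * (ρ ^ (mIdx lam * p * d))⁻¹ * ρ ^ k) atTop
        (𝓝 0) := by
      simpa using (tendsto_pow_atTop_nhds_zero_of_lt_one hρ0.le hρ1).const_mul
        (sigma p lam a * (ρ ^ (mIdx lam * p * d))⁻¹)
    refine squeeze_zero' (Eventually.of_forall fun k => by positivity) ?_ hlim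
    filter_upwards [eventually_ge_atTop 2] with k hk2
    refine (hbound' k (by omega) (hNle k hk2)).trans ?_
    rw [mul_assoc]
    refine mul_le_mul_of_nonneg_left ?_ hσ0.le
    rw [le_inv_mul_iff₀ (by positivity), ← hρM, ← pow_mul, ← pow_add]
    refine pow_le_pow_of_le_one hρ0.le hρ1.le ?_
    have := le_mul_sub_countAP hd2 hdM k
    change k ≤ mIdx lam * p * d + mIdx lam * p * (k - 1 - (d - 1) * countAP d _ k)
    omega

theorem SelfBounded.map {L M : Type*} [NontriviallyNormedField L] [NontriviallyNormedField M]
    {φ : L →+* M} (hφ : ∀ x, ‖φ x‖ = ‖x‖) {f : L⟦X⟧} {r : ℝ} (hf : SelfBounded f r) :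
    SelfBounded (f.map φ) r := fun k => by rw [coeff_map, hφ]; exact hf k

theorem CriticalConjugacy.map {L M : Type*} [NontriviallyNormedField L]
    [NontriviallyNormedField M] {φ : L →+* M} (hφ : ∀ x, ‖φ x‖ = ‖x‖) {p d : ℕ} {f g : L⟦X⟧}
    {σ : ℝ} (h : CriticalConjugacy p f g σ d) (hroot : ∀ n : ℕ, 1 ≤ n → f.coeff 1 ^ n ≠ 1) :
    CriticalConjugacy p (f.map φ) (g.map φ) σ d where
  coeff_zero := by rw [coeff_map, h.coeff_zero, map_zero]
  norm_coeff_one := by rw [coeff_map, hφ, h.norm_coeff_one]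
  coeff_eq_zero i hi hpi := by rw [coeff_map, h.coeff_eq_zero i hi hpi, map_zero]
  conj := h.conj.map φ h.coeff_zero
  unique g' hg' := by
    refine IsFormalConjugacy.unique (f := f.map φ) ?_ ?_ ?_ (h.conj.map φ h.coeff_zero) hg'
    · rw [coeff_map, h.coeff_zero, map_zero]
    · rw [← norm_ne_zero_iff, coeff_map, hφ, h.norm_coeff_one]; exact one_ne_zero
    · intro n hn e
      rw [coeff_map, ← map_pow] at e
      exact hroot n hn (φ.injective (e.trans (map_one φ).symm))
  conj_coeff_eq_zero i hi hpi := by rw [coeff_map, h.conj_coeff_eq_zero i hi hpi, map_zero]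
  radius_pos := h.radius_pos
  exists_radius := h.exists_radius.imp fun _ hr => ⟨hr.1, hr.2.map hφ⟩
  two_le := h.two_le
  norm_coeff_eq := by rw [coeff_map, hφ, h.norm_coeff_eq]
  exists_norm_coeff_le := by simpa only [coeff_map, hφ] using h.exists_norm_coeff_le
  tendsto_zero := by simpa only [coeff_map, hφ] using h.tendsto_zero

end Data

/-! ### The linearization disc -/

namespace CriticalConjugacy

open PowerSeries Finset Filter Topology

variable {L : Type*} [NontriviallyNormedField L] {p d : ℕ} {f g : L⟦X⟧} {σ : ℝ}

theorem selfBounded_conj (H : CriticalConjugacy p f g σ d) : SelfBounded g σ := by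
  intro k
  obtain ⟨τ, hτ1, hτ0, hτ⟩ := H.exists_norm_coeff_le
  rcases Nat.lt_or_ge k 2 with hk | hk
  · interval_cases k
    · simp [H.conj.1, H.radius_pos.le]
    · simp [H.conj.2.1]
  · rcases eq_or_ne k d with rfl | hkd
    · exact H.norm_coeff_eq.le
    · exact (hτ k hk hkd).trans (mul_le_of_le_one_right H.radius_pos.le hτ1.le)

theorem hasWeierstrassDegree (H : CriticalConjugacy p f g σ d)
    (hu : ∃ u : L, σ ≤ ‖u‖ ∧ ∀ x : L, ‖x‖ ≤ ‖u‖ → ConvergesAt g x) :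
    HasWeierstrassDegree g σ d := by
  refine ⟨fun h => ?_, H.radius_pos, hu, σ, ⟨⟨1, by simp [H.conj.2.1]⟩, ?_⟩, H.norm_coeff_eq, ?_⟩
  · have := H.conj.2.1
    simp [h] at this
  · rintro t ⟨k, rfl⟩
    exact H.selfBounded_conj k
  · intro k hk
    by_contra! hdk
    obtain ⟨τ, hτ1, hτ0, hτ⟩ := H.exists_norm_coeff_le
    have h1 := hτ k (by have := H.two_le; omega) hdk.ne'
    rw [show ‖g.coeff k‖ * σ ^ k = σ from hk] at h1
    exact h1.not_gt (mul_lt_of_lt_one_right H.radius_pos hτ1)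

variable [IsUltrametricDist L] [CompleteSpace L]

theorem convergesAt_conj (H : CriticalConjugacy p f g σ d) {x : L} (hx : ‖x‖ ≤ σ) :
    ConvergesAt g x :=
  convergesAt_of_tendsto <| squeeze_zero (fun k => by positivity)
    (fun k => by gcongr) H.tendsto_zero

theorem convergesAt (H : CriticalConjugacy p f g σ d) {x : L} (hx : ‖x‖ ≤ σ) :
    ConvergesAt f x := by
  obtain ⟨r, hr, hf⟩ := H.exists_radius
  exact hf.convergesAt (hx.trans_lt hr)

omit [IsUltrametricDist L] [CompleteSpace L] in
theorem selfBounded (H : CriticalConjugacy p f g σ d) {x : L} (hx : ‖x‖ ≤ σ) :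
    SelfBounded f ‖x‖ := by
  obtain ⟨r, hr, hf⟩ := H.exists_radius
  exact hf.mono H.coeff_zero (norm_nonneg x) (hx.trans hr.le)

/-- The functional equation holds on the closed disc of radius `σ`. -/
theorem evalAt_conj (H : CriticalConjugacy p f g σ d) {x : L} (hx : ‖x‖ ≤ σ) :
    ConvergesAt g (evalAt f x) ∧ evalAt g (evalAt f x) = f.coeff 1 * evalAt g x := by
  obtain ⟨h1, h2⟩ := evalAt_subst H.coeff_zero (H.selfBounded hx) (H.convergesAt hx)
    (H.convergesAt_conj hx)
  refine ⟨h1, h2.trans ?_⟩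
  rw [H.conj.2.2, evalAt, evalAt, ← tsum_mul_left]
  exact tsum_congr fun k => by rw [coeff_C_mul, mul_assoc]

omit [IsUltrametricDist L] [CompleteSpace L] in
theorem _root_.NonArchLin.evalAt_X (x : L) : evalAt (X : L⟦X⟧) x = x := by
  rw [evalAt, tsum_eq_single 1 fun k hk => by simp [coeff_X, hk]]
  simp

theorem fullConjugacyAt (H : CriticalConjugacy p f g σ d) {h : L⟦X⟧} (hh : IsFormalInverse g h)
    {x : L} (hx : ‖x‖ < σ) : FullConjugacyAt f g h x := by
  have hhσ : SelfBounded h σ :=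
    hh.selfBounded H.radius_pos H.conj.1 H.conj.2.1 H.selfBounded_conj
  have hhx : SelfBounded h ‖x‖ := hhσ.mono hh.1 (norm_nonneg x) hx.le
  have hconv := hhσ.convergesAt hx
  obtain ⟨h1, h2⟩ := evalAt_subst hh.1 hhx hconv (H.convergesAt_conj hx.le)
  rw [hh.2, evalAt_X] at h2
  have hy : ‖evalAt h x‖ ≤ σ := hhx.norm_evalAt_le.trans hx.le
  obtain ⟨h3, h4⟩ := H.evalAt_conj hy
  exact ⟨hconv, h1, h2, H.convergesAt hy, h3, by rw [h4, h2]⟩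

/-- The linearization disc is the open disc of radius `σ` as soon as the inverse of `g` does not
converge on the circle of radius `σ`, which is a condition on its coefficients. -/
theorem isLinearizationDisc (H : CriticalConjugacy p f g σ d)
    (hdiv : ∀ h, IsFormalInverse g h → ¬ Tendsto (fun k => ‖h.coeff k‖ * σ ^ k) atTop (𝓝 0)) :
    IsLinearizationDisc f (Metric.ball 0 σ) := by
  refine ⟨⟨⟨σ, H.radius_pos, Or.inl rfl⟩, ?_⟩, ?_⟩
  · obtain ⟨h, hh⟩ := exists_isFormalInverse H.conj.1 H.conj.2.1
    exact ⟨g, h, H.conj, hh, fun x hx => H.fullConjugacyAt hh (by simpa using hx)⟩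
  · rintro V ⟨-, g', h, hg', hh, hV⟩ x hxV
    obtain rfl := H.unique g' hg'
    rw [mem_ball_zero_iff]
    by_contra! hx
    have hσ := H.radius_pos.le
    exact hdiv h hh (squeeze_zero (fun k => by positivity)
      (fun k => by gcongr) (hV x hxV).1.tendsto)

/-! ### Zeros of the conjugacy on the critical circle -/

theorem exists_norm_evalAt_sub_trunc_le (H : CriticalConjugacy p f g σ d) :
    ∃ τ < 1, 0 ≤ τ ∧ ∀ x : L, ‖x‖ ≤ σ →
      ‖evalAt g x - ∑ k ∈ range (d + 1), g.coeff k * x ^ k‖ ≤ σ * τ := by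
  obtain ⟨τ, hτ1, hτ0, hτ⟩ := H.exists_norm_coeff_le
  refine ⟨τ, hτ1, hτ0, fun x hx => ?_⟩
  have hσ := H.radius_pos
  have h := Summable.sum_add_tsum_nat_add (d + 1) (H.convergesAt_conj hx)
  change _ = evalAt g x at h
  rw [← h, add_sub_cancel_left]
  refine IsUltrametricDist.norm_tsum_le_of_forall_le_of_nonneg (by positivity) fun k => ?_
  rw [norm_mul, norm_pow]
  refine le_trans ?_ (hτ (k + (d + 1)) (by have := H.two_le; omega) (by omega))
  gcongr

omit [CompleteSpace L] in
/-- The nonzero roots of the truncation of `g` at its Weierstrass degree lie on the circle of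
radius `σ`: inside the constant term dominates, outside the leading term does. -/
theorem norm_eq_of_sum_eq_zero (H : CriticalConjugacy p f g σ d) {y : L}
    (hy : ∑ k ∈ range d, g.coeff (k + 1) * y ^ k = 0) : ‖y‖ = σ := by
  have hσ := H.radius_pos
  obtain ⟨e, rfl⟩ : ∃ e, d = e + 2 := ⟨d - 2, by have := H.two_le; omega⟩
  have hle : ∀ k, ‖g.coeff (k + 1)‖ * σ ^ k ≤ 1 := fun k => by
    have := H.selfBounded_conj (k + 1)
    rw [pow_succ, ← mul_assoc] at this
    exact le_of_mul_le_mul_right (by linarith) hσ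
  have hlead : ‖g.coeff (e + 1 + 1)‖ * σ ^ (e + 1) = 1 := by
    have := H.norm_coeff_eq
    rw [pow_succ, ← mul_assoc] at this
    exact mul_right_cancel₀ hσ.ne' (by linarith)
  have hscale : ∀ k, ‖g.coeff (k + 1) * y ^ k‖ =
      (‖g.coeff (k + 1)‖ * σ ^ k) * (‖y‖ / σ) ^ k := fun k => by
    rw [norm_mul, norm_pow, div_pow]; field_simp
  refine le_antisymm (le_of_not_gt fun hlt => ?_) (le_of_not_gt fun hlt => ?_)
  · have ht : 1 < ‖y‖ / σ := (one_lt_div hσ).2 hlt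
    rw [sum_range_succ] at hy
    have h1 : ‖∑ k ∈ range (e + 1), g.coeff (k + 1) * y ^ k‖ < (‖y‖ / σ) ^ (e + 1) := by
      refine norm_sum_lt_of_forall_lt (by positivity) fun k hk => ?_
      rw [hscale]
      exact (mul_le_of_le_one_left (by positivity) (hle k)).trans_lt
        (pow_lt_pow_right₀ ht (mem_range.1 hk))
    rw [eq_neg_of_add_eq_zero_left hy, norm_neg, hscale, hlead, one_mul] at h1
    exact lt_irrefl _ h1
  · have ht : ‖y‖ / σ < 1 := (div_lt_one hσ).2 hlt
    rw [sum_range_succ'] at hy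
    have h1 : ‖∑ k ∈ range (e + 1), g.coeff (k + 1 + 1) * y ^ (k + 1)‖ < 1 := by
      refine norm_sum_lt_of_forall_lt one_pos fun k hk => ?_
      rw [hscale]
      exact (mul_le_of_le_one_left (by positivity) (hle _)).trans_lt
        (pow_lt_one₀ (by positivity) ht (Nat.succ_ne_zero k))
    rw [eq_neg_of_add_eq_zero_left hy] at h1
    simp [H.conj.2.1] at h1

variable [Fact p.Prime] [CharP L p]

theorem norm_evalAt_conj_sub_sub_le (H : CriticalConjugacy p f g σ d) {x y : L} (hx : ‖x‖ ≤ σ)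
    (hy : ‖y‖ ≤ σ) : ‖evalAt g x - evalAt g y - (x - y)‖ ≤ σ * (‖x - y‖ / σ) ^ p := by
  have h := norm_evalAt_sub_sub_le H.radius_pos H.selfBounded_conj H.conj_coeff_eq_zero hx hy
    (H.convergesAt_conj hx) (H.convergesAt_conj hy)
  rwa [H.conj.2.1, one_mul] at h

/-- As `g' = 1`, the iteration `x ↦ x - g x` is a contraction near an approximate zero of `g`, and
converges to a zero. -/
theorem exists_zero_of_norm_lt (H : CriticalConjugacy p f g σ d) {x₀ : L} (hx₀ : ‖x₀‖ = σ)
    (hlt : ‖evalAt g x₀‖ < σ) : ∃ z : L, ‖z‖ = σ ∧ evalAt g z = 0 := by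
  have hσ := H.radius_pos
  set ε := ‖evalAt g x₀‖ with hε
  have hq1 : ε / σ < 1 := (div_lt_one hσ).2 hlt
  have hq0 : 0 ≤ ε / σ := by positivity
  have hball : ∀ x ∈ Metric.closedBall x₀ ε, ‖x‖ = σ := fun x hx => by
    rw [mem_closedBall_iff_norm] at hx
    rw [← add_sub_cancel x₀ x, norm_add_eq_left (by rw [hx₀]; exact hx.trans_lt hlt), hx₀]
  have hcontr : ∀ x ∈ Metric.closedBall x₀ ε, ∀ y ∈ Metric.closedBall x₀ ε,
      ‖(x - evalAt g x) - (y - evalAt g y)‖ ≤ ε / σ * ‖x - y‖ := by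
    intro x hx y hy
    have hxy : ‖x - y‖ ≤ ε := by
      rw [← dist_eq_norm]
      rw [Metric.mem_closedBall] at hx hy
      exact (dist_triangle_max x x₀ y).trans (max_le hx (by rwa [dist_comm]))
    rw [show (x - evalAt g x) - (y - evalAt g y) = -(evalAt g x - evalAt g y - (x - y)) by ring,
      norm_neg]
    refine (H.norm_evalAt_conj_sub_sub_le (hball x hx).le (hball y hy).le).trans ?_
    have ht : ‖x - y‖ / σ ≤ ε / σ := by gcongr
    calc σ * (‖x - y‖ / σ) ^ p ≤ σ * (‖x - y‖ / σ) ^ 2 := by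
          gcongr ?_ * ?_
          exact pow_le_pow_of_le_one (by positivity) (ht.trans hq1.le)
            (Fact.out : p.Prime).two_le
      _ = (‖x - y‖ / σ) * ‖x - y‖ := by field_simp
      _ ≤ ε / σ * ‖x - y‖ := by gcongr
  have hx₀mem : x₀ ∈ Metric.closedBall x₀ ε := Metric.mem_closedBall_self (norm_nonneg _)
  have hmaps : Set.MapsTo (fun x => x - evalAt g x) (Metric.closedBall x₀ ε)
      (Metric.closedBall x₀ ε) := by
    intro x hx
    have h1 := hcontr x hx x₀ hx₀mem
    have hx' := hx
    rw [mem_closedBall_iff_norm] at hx' ⊢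
    rw [show x - evalAt g x - x₀ = ((x - evalAt g x) - (x₀ - evalAt g x₀)) + -evalAt g x₀ by ring]
    refine (IsUltrametricDist.norm_add_le_max _ _).trans (max_le ?_ (by rw [norm_neg]))
    exact h1.trans ((mul_le_of_le_one_left (norm_nonneg _) hq1.le).trans hx')
  have hcw : ContractingWith ⟨ε / σ, hq0⟩ (hmaps.restrict _ _ _) :=
    ⟨hq1, LipschitzWith.of_dist_le_mul fun x y => by
      rw [Subtype.dist_eq, Subtype.dist_eq, dist_eq_norm, dist_eq_norm]
      exact hcontr x x.2 y y.2⟩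
  obtain ⟨z, hz, hfix, -⟩ := hcw.exists_fixedPoint' Metric.isClosed_closedBall.isComplete hmaps
    hx₀mem (edist_ne_top _ _)
  exact ⟨z, hball z hz, sub_eq_self.1 hfix⟩

omit [Fact p.Prime] [CharP L p] in
/-- If `g` has a zero on the critical circle, its inverse cannot converge there: it would map `0`
both to `0` and to that zero. -/
theorem not_tendsto_of_zero (H : CriticalConjugacy p f g σ d) {z : L} (hz : ‖z‖ = σ)
    (hgz : evalAt g z = 0) {h : L⟦X⟧} (hh : IsFormalInverse g h) :
    ¬ Tendsto (fun k => ‖h.coeff k‖ * σ ^ k) atTop (𝓝 0) := by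
  intro hlim
  have e := (evalAt_subst (f := g) (g := h) (x := z) H.conj.1
    (by rw [hz]; exact H.selfBounded_conj) (H.convergesAt_conj hz.le)
    (convergesAt_of_tendsto (by rwa [hz]))).2
  rw [hh.subst_left H.conj.1 H.conj.2.1, evalAt_X, hgz] at e
  have h0 : evalAt h (0 : L) = 0 := by
    rw [evalAt, tsum_eq_single 0 fun k hk => by simp [hk]]
    simp [hh.1]
  rw [← e, h0, norm_zero] at hz
  exact H.radius_pos.ne hz

theorem _root_.NonArchLin.mul_div_pow_lt {r t : ℝ} (hr : 0 < r) (ht0 : 0 < t) (htr : t < r)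
    {n : ℕ} (hn : 2 ≤ n) : r * (t / r) ^ n < t := by
  have h1 : (t / r) ^ n < (t / r) ^ 1 :=
    pow_lt_pow_right_of_lt_one₀ (by positivity) ((div_lt_one hr).2 htr) (by omega)
  calc r * (t / r) ^ n < r * (t / r) ^ 1 := by gcongr
    _ = t := by field_simp

/-- Distinct zeros of `g` are at distance exactly `σ`, since `g` is isometric at smaller scales. -/
theorem norm_sub_eq_of_zeros (H : CriticalConjugacy p f g σ d) {x y : L} (hx : ‖x‖ ≤ σ)
    (hy : ‖y‖ ≤ σ) (hgx : evalAt g x = 0) (hgy : evalAt g y = 0) (hxy : x ≠ y) :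
    ‖x - y‖ = σ := by
  have hle : ‖x - y‖ ≤ σ := by
    rw [sub_eq_add_neg]
    exact (IsUltrametricDist.norm_add_le_max _ _).trans (max_le hx (by rwa [norm_neg]))
  refine hle.eq_of_not_lt fun hlt => ?_
  have h := H.norm_evalAt_conj_sub_sub_le hx hy
  rw [hgx, hgy, sub_zero, zero_sub, norm_neg] at h
  exact h.not_gt (mul_div_pow_lt H.radius_pos (norm_pos_iff.2 (sub_ne_zero.2 hxy)) hlt
    (Fact.out : p.Prime).two_le)

/-- There are at most `d` zeros of `g` in the closed disc of radius `σ`. Otherwise, Lagrange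
interpolation of the truncation of `g` at `d + 1` zeros, where it is small, would show that its
leading coefficient is too small. -/
theorem card_zeros_le (H : CriticalConjugacy p f g σ d) (S : Finset L)
    (hS : ∀ x ∈ S, ‖x‖ ≤ σ ∧ evalAt g x = 0) : #S ≤ d := by
  classical
  by_contra! hlt
  obtain ⟨S', hS', hcard⟩ := exists_subset_card_eq (Nat.succ_le_of_lt hlt)
  have hσ := H.radius_pos
  obtain ⟨τ, hτ1, hτ0, hτ⟩ := H.exists_norm_evalAt_sub_trunc_le
  have hsum := Lagrange.coeff_eq_sum (s := S') (v := id) (Set.injOn_id _)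
    (P := PowerSeries.trunc (d + 1) g) (by rw [hcard]; exact_mod_cast degree_trunc_lt g (d + 1))
  rw [hcard, Nat.succ_sub_one, coeff_trunc, if_pos (Nat.lt_succ_self d)] at hsum
  have hle : ‖g.coeff d‖ ≤ σ * τ / σ ^ d := by
    rw [hsum]
    refine IsUltrametricDist.norm_sum_le_of_forall_le_of_nonneg (by positivity) fun x hx => ?_
    obtain ⟨hx1, hx2⟩ := hS x (hS' hx)
    have hprod : ‖∏ y ∈ S'.erase x, (id x - id y)‖ = σ ^ d := by
      rw [norm_prod, prod_congr rfl fun y hy => ?_, prod_const, card_erase_of_mem hx, hcard,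
        Nat.succ_sub_one]
      have hy' := mem_erase.1 hy
      obtain ⟨hy1, hy2⟩ := hS y (hS' hy'.2)
      exact H.norm_sub_eq_of_zeros hx1 hy1 hx2 hy2 hy'.1.symm
    rw [norm_div, hprod]
    gcongr
    have := hτ x hx1
    rw [hx2, zero_sub, norm_neg] at this
    rw [Polynomial.eval, eval₂_trunc_eq_sum_range]
    simpa using this
  rw [le_div_iff₀ (by positivity), H.norm_coeff_eq] at hle
  exact hle.not_gt (mul_lt_of_lt_one_right hσ hτ1)

/-! ### Periodic points on the critical circle -/

theorem norm_evalAt_sub (H : CriticalConjugacy p f g σ d) {x y : L} (hx : ‖x‖ ≤ σ)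
    (hy : ‖y‖ ≤ σ) : ‖evalAt f x - evalAt f y‖ = ‖x - y‖ := by
  rcases eq_or_ne x y with rfl | hxy
  · simp
  obtain ⟨r, hr, hf⟩ := H.exists_radius
  have hle : ‖x - y‖ ≤ σ := by
    rw [sub_eq_add_neg]
    exact (IsUltrametricDist.norm_add_le_max _ _).trans (max_le hx (by rwa [norm_neg]))
  have h := (norm_evalAt_sub_sub_le (H.radius_pos.trans hr) hf H.coeff_eq_zero (hx.trans hr.le)
    (hy.trans hr.le) (H.convergesAt hx) (H.convergesAt hy)).trans_lt
    (mul_div_pow_lt (H.radius_pos.trans hr) (norm_pos_iff.2 (sub_ne_zero.2 hxy)) (hle.trans_lt hr)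
      (Fact.out : p.Prime).two_le)
  have hlin : ‖f.coeff 1 * (x - y)‖ = ‖x - y‖ := by rw [norm_mul, H.norm_coeff_one, one_mul]
  rw [← add_sub_cancel (f.coeff 1 * (x - y)) (evalAt f x - evalAt f y),
    norm_add_eq_left (by rwa [hlin]), hlin]

theorem norm_evalAt (H : CriticalConjugacy p f g σ d) {x : L} (hx : ‖x‖ ≤ σ) :
    ‖evalAt f x‖ = ‖x‖ := by
  have h := H.norm_evalAt_sub hx (y := 0) (by simpa using H.radius_pos.le)
  have h0 : evalAt f (0 : L) = 0 := by
    rw [evalAt, tsum_eq_single 0 fun k hk => by simp [hk]]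
    simp [H.coeff_zero]
  rwa [h0, sub_zero, sub_zero] at h

theorem iterate_mem (H : CriticalConjugacy p f g σ d) {z : L} (hz : ‖z‖ = σ)
    (hgz : evalAt g z = 0) (n : ℕ) :
    ‖(evalAt f)^[n] z‖ = σ ∧ evalAt g ((evalAt f)^[n] z) = 0 := by
  induction n with
  | zero => exact ⟨hz, hgz⟩
  | succ n ih =>
    rw [Function.iterate_succ_apply']
    exact ⟨by rw [H.norm_evalAt ih.1.le, ih.1], by rw [(H.evalAt_conj ih.1.le).2, ih.2, mul_zero]⟩

/-- The isometry `f` permutes the finite set of zeros of `g` on the critical circle, so these zeros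
are periodic. -/
theorem isIndifferentPeriodicPoint_of_zero (H : CriticalConjugacy p f g σ d) {z : L}
    (hz : ‖z‖ = σ) (hgz : evalAt g z = 0) :
    ∃ κ ≤ d, IsIndifferentPeriodicPoint f z κ (f.coeff 1 ^ κ) := by
  classical
  have hmem := H.iterate_mem hz hgz
  obtain ⟨i, j, hij, hjd, heq⟩ : ∃ i j, i < j ∧ j ≤ d ∧
      (evalAt f)^[i] z = (evalAt f)^[j] z := by
    by_contra! hne
    have hinj : Set.InjOn (fun n => (evalAt f)^[n] z) (range (d + 1)) := by
      intro i hi j hj hij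
      rw [mem_coe, mem_range] at hi hj
      rcases lt_trichotomy i j with h | h | h
      · exact absurd hij (hne i j h (by omega))
      · exact h
      · exact absurd hij.symm (hne j i h (by omega))
    have := H.card_zeros_le ((range (d + 1)).image fun n => (evalAt f)^[n] z) fun x hx => by
      obtain ⟨n, -, rfl⟩ := mem_image.1 hx
      exact ⟨(hmem n).1.le, (hmem n).2⟩
    rw [card_image_of_injOn hinj, card_range] at this
    omega
  have hinj : Set.InjOn (evalAt f) (Metric.closedBall 0 σ) := fun x hx y hy hxy => by
    rw [mem_closedBall_zero_iff] at hx hy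
    have := H.norm_evalAt_sub hx hy
    rw [hxy, sub_self, norm_zero] at this
    exact sub_eq_zero.1 (norm_eq_zero.1 this.symm)
  have hmaps : Set.MapsTo (evalAt f) (Metric.closedBall 0 σ) (Metric.closedBall 0 σ) :=
    fun x hx => by
      rw [mem_closedBall_zero_iff] at hx ⊢
      rwa [H.norm_evalAt hx]
  have hper : Function.IsPeriodicPt (evalAt f) (j - i) z := by
    refine hinj.iterate hmaps i ?_ ?_ ?_
    · rw [mem_closedBall_zero_iff]; exact (hmem _).1.le
    · rw [mem_closedBall_zero_iff]; exact hz.le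
    · rw [← Function.iterate_add_apply, Nat.add_sub_cancel' hij.le, heq]
  have hderiv : ∀ n, HasDerivAt (evalAt f)^[n] (f.coeff 1 ^ n) z := by
    intro n
    induction n with
    | zero => simpa using hasDerivAt_id z
    | succ n ih =>
      obtain ⟨r, hr, hf⟩ := H.exists_radius
      rw [Function.iterate_succ', pow_succ']
      exact (hasDerivAt_evalAt hf H.coeff_eq_zero ((hmem n).1.trans_lt hr)).comp z ih
  refine ⟨Function.minimalPeriod (evalAt f) z, ?_, fun n => H.convergesAt (hmem n).1.le, ?_, rfl,
    hderiv _, by rw [norm_pow, H.norm_coeff_one, one_pow]⟩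
  · exact (hper.minimalPeriod_le (by omega)).trans (by omega)
  · exact hper.minimalPeriod_pos (by omega)

end CriticalConjugacy

/-! ### The zero of the conjugacy in `K̂` -/

section Completion

open PowerSeries Finset

variable (p : ℕ) [Fact p.Prime] (K : Type*) [NontriviallyNormedField K] [CompleteSpace K]
  [CharP K p]

theorem charP_khat : CharP (Khat p K) p :=
  charP_of_injective_ringHom (toKhat p K).injective p

theorem exists_eval₂_toKhat_eq_zero {P : Polynomial K} (hP : P.natDegree ≠ 0) :
    ∃ y : Khat p K, P.eval₂ (toKhat p K) y = 0 := by
  obtain ⟨x, hx⟩ : ∃ x : AlgCl p K, P.eval₂ (toAlgCl p K) x = 0 :=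
    IsAlgClosed.exists_eval₂_eq_zero (algebraMap K (AlgebraicClosure K)) P
      fun h => hP (Polynomial.natDegree_eq_zero_iff_degree_le_zero.2 h.le)
  refine ⟨UniformSpace.Completion.coeRingHom (α := AlgCl p K) x, ?_⟩
  have h := congrArg (UniformSpace.Completion.coeRingHom (α := AlgCl p K)) hx
  rw [map_zero] at h
  exact (Polynomial.hom_eval₂ P (toAlgCl p K) _ x).symm.trans h

variable {p K} in
/-- The conjugacy has a zero on the critical circle in `K̂`, lying close to a root of its
truncation of degree `d`. -/
theorem CriticalConjugacy.exists_zero {f g : K⟦X⟧} {σ : ℝ} {d : ℕ}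
    (H : CriticalConjugacy p f g σ d)
    (Hhat : CriticalConjugacy p (f.map (toKhat p K)) (g.map (toKhat p K)) σ d) :
    ∃ z : Khat p K, ‖z‖ = σ ∧ evalAt (g.map (toKhat p K)) z = 0 := by
  have : CharP (Khat p K) p := charP_khat p K
  have : IsUltrametricDist (Khat p K) := isUltrametricDist_of_charP p _
  have hσ := H.radius_pos
  -- the polynomial `Q` such that `x * Q x` is the truncation of `g`
  set Q : Polynomial K := PowerSeries.trunc d (PowerSeries.mk fun k => g.coeff (k + 1)) with hQ
  have hQd : Q.natDegree ≠ 0 := by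
    have h2 := H.two_le
    have hc : Q.coeff (d - 1) ≠ 0 := by
      rw [hQ, coeff_trunc, if_pos (by omega), coeff_mk, Nat.sub_add_cancel (by omega)]
      intro h
      have := H.norm_coeff_eq
      rw [h, norm_zero, zero_mul] at this
      exact hσ.ne this
    have := Polynomial.le_natDegree_of_ne_zero hc
    omega
  obtain ⟨y, hy⟩ := exists_eval₂_toKhat_eq_zero p K hQd
  rw [hQ, eval₂_trunc_eq_sum_range] at hy
  have hy' : ∑ k ∈ range d, (g.map (toKhat p K)).coeff (k + 1) * y ^ k = 0 := by
    simpa only [coeff_map, coeff_mk] using hy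
  have hyσ := Hhat.norm_eq_of_sum_eq_zero hy'
  refine Hhat.exists_zero_of_norm_lt hyσ ?_
  obtain ⟨τ, hτ1, -, hτ⟩ := Hhat.exists_norm_evalAt_sub_trunc_le
  have htrunc : ∑ k ∈ range (d + 1), (g.map (toKhat p K)).coeff k * y ^ k = 0 := by
    rw [sum_range_succ', Hhat.conj.1, zero_mul, add_zero]
    simp only [pow_succ, ← mul_assoc]
    rw [← sum_mul, hy', zero_mul]
  have h := hτ y hyσ.le
  rw [htrunc, sub_zero] at h
  exact h.trans_lt (mul_lt_of_lt_one_right hσ hτ1)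

end Completion

end NonArchLin

theorem mainTheorem5 (p : ℕ) [Fact p.Prime] (K : Type*) [NontriviallyNormedField K]
    [CompleteSpace K] [CharP K p] (lam : K)
    (hroot : ∀ n : ℕ, 1 ≤ n → lam ^ n ≠ 1)
    (hm : ∃ n : ℕ, 1 ≤ n ∧ ‖1 - lam ^ n‖ < 1)
    (a : ℝ) (ha : 0 < a) (f : PowerSeries K) (hf : f ∈ family p lam a)
    (hk : a = ‖f.coeff (kPrime p lam)‖ ^ (1 / ((kPrime p lam : ℝ) - 1)))
    (hlt : ∀ i : ℕ, 2 ≤ i → i < kPrime p lam → ‖f.coeff i‖ < a ^ (i - 1)) :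
    IsLinearizationDisc f (Metric.ball 0 (sigma p lam a)) ∧
    IsLinearizationDisc (f.map (toKhat p K)) (Metric.ball 0 (sigma p lam a)) ∧
    (∃ g : PowerSeries K, IsFormalConjugacy f g ∧
      (∀ g' : PowerSeries K, IsFormalConjugacy f g' → g' = g) ∧
      HasWeierstrassDegree (g.map (toKhat p K)) (sigma p lam a) (kPrime p lam)) ∧
    ∃ (x : Khat p K) (κ : ℕ), ‖x‖ = sigma p lam a ∧ κ ≤ kPrime p lam ∧
      IsIndifferentPeriodicPoint (f.map (toKhat p K)) x κ (toKhat p K (lam ^ κ)) := by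
  have : IsUltrametricDist K := isUltrametricDist_of_charP p K
  have : CharP (Khat p K) p := charP_khat p K
  have : IsUltrametricDist (Khat p K) := isUltrametricDist_of_charP p _
  have hnorm := norm_toKhat p K
  obtain ⟨g, H⟩ := CriticalConjugacy.of_family hroot hm ha hf hk hlt
  have h1 : f.coeff 1 = lam := hf.2.1
  have Hhat := H.map hnorm (by rwa [h1])
  obtain ⟨z, hz, hgz⟩ := H.exists_zero Hhat
  have hdiv : ∀ h, IsFormalInverse (g.map (toKhat p K)) h → _ := fun h hh =>
    Hhat.not_tendsto_of_zero hz hgz hh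
  refine ⟨H.isLinearizationDisc fun h hh hlim => ?_, Hhat.isLinearizationDisc hdiv,
    ⟨g, H.conj, H.unique, Hhat.hasWeierstrassDegree
      ⟨z, hz.ge, fun x hx => Hhat.convergesAt_conj (hx.trans hz.le)⟩⟩, ?_⟩
  · -- the circle of radius `σ` may be empty in `K`, but the coefficients can be tested in `K̂`
    refine hdiv _ (hh.map (toKhat p K)) ?_
    simpa only [PowerSeries.coeff_map, hnorm] using hlim
  · obtain ⟨κ, hκ, hper⟩ := Hhat.isIndifferentPeriodicPoint_of_zero hz hgz
    refine ⟨z, κ, hz, hκ, ?_⟩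
    rwa [PowerSeries.coeff_map, h1, ← map_pow] at hper
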